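/- Fix an integer $d$, equip $\mathbb{R}^d$ with the norm $\|x\|=\max_i|x_i|$, and let $B_1=[-1,1]^d$. Let $\mathcal{M}$ be the space of Radon (locally finite Borel) measures on $\mathbb{R}^d$, $\mathcal{M}^*=\{\mu\in\mathcal{M}:\mu(B_1)=1\}$ and $\mathcal{M}^\square=\{\mu\in\mathcal M:\mu \text{ is a probability measure on } B_1\}$. For $\mu(B_1)>0$ put $\mu^*=\mu/\mu(B_1)$ and $\mu^\square=\mu^*|_{B_1}$. Let $T_x(y)=y-x$ and $S_t(y)=e^ty$ act on measures by push-forward; a superscript $*$ or $\square$ on an operation means that the corresponding normalization is applied afterwards, e.g. $T_x^*\mu=(T_x\mu)^*$, $S_t^*\mu=(S_t\mu)^*$. A *fractal distribution* is a probability measure $P$ on $\mathcal{M}^*$ that is $S_t^*$-invariant for every $t\in\mathbb{R}$ and *quasi-Palm*: for every bounded open neighbourhood $U$ of $0$, the measures $P$ and $\int\big(\int_U\delta_{T_x^*\mu}\,d\mu(x)\big)\,dP(\mu)$ have the same null sets. Let $b\ge 2$ be an integer and let $\mathcal{D}_b$ be the partition of $\mathbb{R}^d$ into the cells $\prod_{i=1}^d[\frac{k_i}{b},\frac{k_i+2}{b})$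 with $k_i\equiv b \pmod 2$. Let $\mathcal{D}_b(x)$ be the cell containing $x$ and $T_{\mathcal{D}_b(x)}(y)=b(y-c)$, where $c$ is the centre of $\mathcal{D}_b(x)$. Put $M_b^{*}(\mu,x)=(T^{*}_{\mathcal{D}_b(x)}\mu,\;T_{\mathcal{D}_b(x)}x)$ and $M_b^{\square}(\mu,x)=(T^{\square}_{\mathcal{D}_b(x)}\mu,\;T_{\mathcal{D}_b(x)}x)$. A *restricted base-$b$ CP-distribution* is an $M_b^\square$-invariant probability measure $Q_0$ on $\mathcal{M}^\square\times B_1$ that is adapted: conditioned on the first component being $\nu$, the second component has distribution $\nu$. Its *extended version* is the distribution of $(\nu,x_0)$ on $\mathcal{M}^*\times B_1$, where $(\mu_n,x_n)_{n\in\mathbb{Z}}$ is the two-sided stationary process with marginal $Q_0$ satisfying $(\mu_{n+1},x_{n+1})=M_b^\square(\mu_n,x_n)$ for all $n$ almost surely, and almost surely $\nu(A)=\lim_{n\to\infty}\big(T^*_{\mathcal{D}_{b^n}(x_{-n})}\mu_{-n}\big)(A)$ for all Borel sets $A\subseteq\mathbb{R}^d$. A *base-$b$ CP-distribution* $Q$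 is the extended version of a restricted one. Its *continuous centering* is $$\operatorname{cent}Q=\frac{1}{\log b}\int_0^{\log b}S_t^*\big(\operatorname{cent}_0Q\big)\,dt,$$ where $\operatorname{cent}_0Q$ is the push-forward of $Q$ under $(\mu,x)\mapsto T_x^*\mu$. The *$c$-suspension* of a measure-preserving system $(\Omega,Q,f)$, $c>0$, is the semiflow $s_t(\omega,r)=\big(f^{\lfloor (r+t)/c\rfloor}\omega,\;c\{(r+t)/c\}\big)$, $t\ge0$, on $\Omega\times[0,c)$ with the product of $Q$ and normalized Lebesgue measure ($\{\cdot\}$ is the fractional part). A measure-preserving semiflow $(P,(s'_t)_{t\ge0})$ is a *factor* of $(R,(s_t)_{t\ge0})$ if there is a measurable map $\pi$ carrying $R$ to $P$ such that, for $R$-a.e. $\omega$, $\pi(s_t\omega)=s'_t\pi(\omega)$ for all $t\ge0$. **Theorem.** For every base-$b$ CP-distribution $Q$, the continuous centering $P=\operatorname{cent}Q$ is a fractal distribution. Moreover $(P,(S_t^*)_{t\ge 0})$ and the $\log b$-suspension of $(\mathcal{M}^*\times B_1,Q,M_b^*)$ are measure-preserving semiflows, and the former is a factor of the latter. -/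

import Mathlib

open MeasureTheory Set Filter Topology

noncomputable section

namespace CPCentering

/-! ### Euclidean space and Radon measures -/

/-- `ℝ^d`; the norm of a function space over `Fin d` is the supremum norm. -/
abbrev E (d : ℕ) : Type := Fin d → ℝ

/-- `B_1 = [-1,1]^d`, the closed unit ball of the supremum norm. -/
def B1 (d : ℕ) : Set (E d) := Metric.closedBall 0 1

/-- The space `𝓜` of Radon (that is, locally finite Borel) measures on `ℝ^d`. Its σ-algebra is
the one induced from `Measure (E d)`, generated by the evaluations `μ ↦ μ A` with `A` Borel; on
Radon measures it is the Borel σ-algebra of the weak-* topology. -/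
abbrev Radon (d : ℕ) : Type := {μ : Measure (E d) // IsLocallyFiniteMeasure μ}

/-- Push-forward of a locally finite measure through a homeomorphism is locally finite. -/
theorem isLocallyFiniteMeasure_map_homeomorph {d : ℕ} (f : E d ≃ₜ E d) (μ : Measure (E d))
    [IsLocallyFiniteMeasure μ] : IsLocallyFiniteMeasure (μ.map f) := by
  refine ⟨fun x => ?_⟩
  obtain ⟨s, hs, hμ⟩ := μ.finiteAt_nhds (f.symm x)
  refine ⟨f.symm ⁻¹' s, f.symm.continuous.continuousAt.preimage_mem_nhds hs, ?_⟩
  have h := f.toMeasurableEquiv.map_apply (μ := μ) (f.symm ⁻¹' s)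
  have h2 : (f.toMeasurableEquiv : E d → E d) ⁻¹' (f.symm ⁻¹' s) = s := by
    ext y; simp
  rw [h2] at h
  exact lt_of_eq_of_lt h hμ

/-- The push-forward `f μ` of a Radon measure through a homeomorphism. -/
def push {d : ℕ} (f : E d ≃ₜ E d) (μ : Radon d) : Radon d :=
  ⟨μ.1.map f, haveI := μ.2; isLocallyFiniteMeasure_map_homeomorph f μ.1⟩

/-- The normalization `μ^* = μ / μ(B_1)`. (It is only meaningful if `μ(B_1) > 0`; otherwise the
value is the zero measure by convention.) -/
def star {d : ℕ} (μ : Radon d) : Radon d :=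
  ⟨(μ.1 (B1 d)).toNNReal⁻¹ • μ.1, haveI := μ.2; inferInstance⟩

/-- The normalization `μ^□ = (μ / μ(B_1))|_{B_1}`. -/
def box {d : ℕ} (μ : Radon d) : Radon d :=
  ⟨(star μ).1.restrict (B1 d), haveI := (star μ).2; inferInstance⟩

/-- `𝓜^* = {μ : μ(B_1) = 1}`. -/
def MStar (d : ℕ) : Set (Radon d) := {μ | μ.1 (B1 d) = 1}

/-- `𝓜^□`: the probability measures on `B_1`. -/
def MBox (d : ℕ) : Set (Radon d) := {μ | μ.1 (B1 d) = 1 ∧ μ.1 (B1 d)ᶜ = 0}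

/-! ### Translation and scaling -/

/-- `T_x (y) = y - x`. -/
def trans {d : ℕ} (x : E d) : E d ≃ₜ E d := Homeomorph.subRight x

/-- `S_t (y) = e^t y`. -/
def scale {d : ℕ} (t : ℝ) : E d ≃ₜ E d :=
  Homeomorph.smulOfNeZero (Real.exp t) (Real.exp_ne_zero t)

/-- `T_x^* μ = (T_x μ)^*`. -/
def transStar {d : ℕ} (x : E d) (μ : Radon d) : Radon d := star (push (trans x) μ)

/-- `S_t^* μ = (S_t μ)^*`. -/
def scaleStar {d : ℕ} (t : ℝ) (μ : Radon d) : Radon d := star (push (scale t) μ)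

/-! ### Fractal distributions -/

/-- The diffusion `⟨μ⟩_U = ∫_U δ_{T_x^* μ} dμ(x)`. -/
def diffusion {d : ℕ} (U : Set (E d)) (μ : Radon d) : Measure (Radon d) :=
  (μ.1.restrict U).map (fun x => transStar x μ)

/-- `P` is quasi-Palm: `P` and `∫ ⟨μ⟩_U dP(μ)` have the same null sets, for every bounded open
neighbourhood `U` of the origin. -/
def QuasiPalm {d : ℕ} (P : Measure (Radon d)) : Prop :=
  ∀ U : Set (E d), IsOpen U → Bornology.IsBounded U → (0 : E d) ∈ U →
    P ≪ P.bind (diffusion U) ∧ P.bind (diffusion U) ≪ P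

/-- A fractal distribution: a probability distribution on `𝓜^*` that is invariant under `S_t^*`
for all `t ∈ ℝ` and quasi-Palm. -/
structure IsFD {d : ℕ} (P : Measure (Radon d)) : Prop where
  prob : IsProbabilityMeasure P
  mem_star : ∀ᵐ μ ∂P, μ ∈ MStar d
  invariant : ∀ t : ℝ, MeasurePreserving (scaleStar t) P P
  quasiPalm : QuasiPalm P

/-! ### The partition `𝓓_b` and magnification -/

/-- The cell `∏ᵢ [kᵢ/b, (kᵢ+2)/b)`; it belongs to `𝓓_b` when every `kᵢ ≡ b (mod 2)`. -/
def cell {d : ℕ} (b : ℕ) (k : Fin d → ℤ) : Set (E d) :=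
  {x | ∀ i, (k i : ℝ) / b ≤ x i ∧ x i < ((k i : ℝ) + 2) / b}

/-- The index of the cell `𝓓_b(x)`, see `mem_cell_iff`. -/
def cellIndex {d : ℕ} (b : ℕ) (x : E d) : Fin d → ℤ :=
  fun i => 2 * ⌊((b : ℝ) * x i + b) / 2⌋ - b

/-- `𝓓_b(x)` is the unique cell of `𝓓_b` that contains `x`. -/
theorem mem_cell_iff {d : ℕ} (b : ℕ) [NeZero b] (x : E d) (k : Fin d → ℤ) :
    (x ∈ cell b k ∧ ∀ i, k i ≡ b [ZMOD 2]) ↔ k = cellIndex b x := by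
  have hb : (0 : ℝ) < b := by exact_mod_cast Nat.pos_of_ne_zero (NeZero.ne b)
  constructor
  · rintro ⟨hx, hk⟩
    funext i
    obtain ⟨h1, h2⟩ := hx i
    rw [div_le_iff₀ hb] at h1
    rw [lt_div_iff₀ hb] at h2
    obtain ⟨j, hj⟩ : ∃ j : ℤ, k i = 2 * j - b := by
      have h := hk i
      unfold Int.ModEq at h
      exact ⟨(k i + b) / 2, by omega⟩
    have hj' : (k i : ℝ) = 2 * j - b := by exact_mod_cast hj
    have hfl : ⌊((b : ℝ) * x i + b) / 2⌋ = j := by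
      rw [Int.floor_eq_iff]
      constructor <;> nlinarith
    simp only [cellIndex, hfl, hj]
  · rintro rfl
    refine ⟨fun i => ?_, fun i => ?_⟩
    · have h1 := Int.floor_le (((b : ℝ) * x i + b) / 2)
      have h2 := Int.lt_floor_add_one (((b : ℝ) * x i + b) / 2)
      simp only [cellIndex]
      push_cast
      rw [div_le_iff₀ hb, lt_div_iff₀ hb]
      constructor <;> nlinarith
    · simp only [cellIndex]
      unfold Int.ModEq
      omega

/-- The centre of the cell `𝓓_b(x)`, a cube of radius `1/b` in the supremum norm. -/
def cellCenter {d : ℕ} (b : ℕ) (x : E d) : E d :=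
  fun i => ((cellIndex b x i : ℝ) + 1) / b

/-- `T_{𝓓_b(x)}`, the orientation-preserving homothety `y ↦ b (y - c)` with `c` the centre of
`𝓓_b(x)`; it maps the closure of `𝓓_b(x)` onto `B_1`. -/
def cellHomothety {d : ℕ} (b : ℕ) [NeZero b] (x : E d) : E d ≃ₜ E d :=
  (trans (cellCenter b x)).trans
    (Homeomorph.smulOfNeZero (b : ℝ) (Nat.cast_ne_zero.mpr (NeZero.ne b)))

/-- `M_b^* (μ, x) = (T_{𝓓_b(x)}^* μ, T_{𝓓_b(x)} x)`. -/
def magStar {d : ℕ} (b : ℕ) [NeZero b] (p : Radon d × E d) : Radon d × E d :=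
  (star (push (cellHomothety b p.2) p.1), cellHomothety b p.2 p.2)

/-- `M_b^□ (μ, x) = (T_{𝓓_b(x)}^□ μ, T_{𝓓_b(x)} x)`. -/
def magBox {d : ℕ} (b : ℕ) [NeZero b] (p : Radon d × E d) : Radon d × E d :=
  (box (push (cellHomothety b p.2) p.1), cellHomothety b p.2 p.2)

/-! ### CP-distributions -/

/-- `Q` is adapted: conditioned on the first component being `ν`, the second component is
distributed according to `ν`. -/
def Adapted {d : ℕ} (Q : Measure (Radon d × E d)) : Prop :=
  ∀ (A : Set (Radon d)) (B : Set (E d)), MeasurableSet A → MeasurableSet B →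
    Q (A ×ˢ B) = ∫⁻ p in A ×ˢ univ, p.1.1 B ∂Q

/-- A restricted base-`b` CP-distribution: an adapted probability distribution on `𝓜^□ × B_1`
that is invariant under `M_b^□`. -/
structure IsRestrictedCP {d : ℕ} (b : ℕ) [NeZero b] (Q : Measure (Radon d × E d)) : Prop where
  prob : IsProbabilityMeasure Q
  mem : ∀ᵐ p ∂Q, p.1 ∈ MBox d ∧ p.2 ∈ B1 d
  adapted : Adapted Q
  invariant : MeasurePreserving (magBox b) Q Q

/-- The measures `ν_n = T_{𝓓_{b^n}(x_{-n})}^* μ_{-n}` of a sequence `(μ_n, x_n)_{n ∈ ℤ}`. -/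
def backward {d : ℕ} (b : ℕ) [NeZero b] (ω : ℤ → Radon d × E d) (n : ℕ) : Radon d :=
  star (push (cellHomothety (b ^ n) (ω (-n)).2) (ω (-n)).1)

/-- `Qt` is the extended version of `Q`: with `(μ_n, x_n)_{n ∈ ℤ}` the two-sided stationary process
(of law `L`) that has marginal `Q` and satisfies `(μ_{n+1}, x_{n+1}) = M_b^□ (μ_n, x_n)`, and
`ν(A) = lim_n ν_n(A)` for all Borel sets `A`, the distribution of `(ν, x_0)` is `Qt`. -/
def IsExtendedVersion {d : ℕ} (b : ℕ) [NeZero b] (Q Qt : Measure (Radon d × E d)) : Prop :=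
  ∃ (L : Measure (ℤ → Radon d × E d)) (ν : (ℤ → Radon d × E d) → Radon d),
    MeasurePreserving (fun (ω : ℤ → Radon d × E d) (n : ℤ) => ω (n + 1)) L L ∧
    L.map (fun ω => ω 0) = Q ∧
    (∀ᵐ ω ∂L, ∀ n : ℤ, ω (n + 1) = magBox b (ω n)) ∧
    Measurable ν ∧
    (∀ᵐ ω ∂L, ∀ A : Set (E d), MeasurableSet A →
      Tendsto (fun n : ℕ => (backward b ω n).1 A) atTop (𝓝 ((ν ω).1 A))) ∧
    L.map (fun ω => (ν ω, (ω 0).2)) = Qt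

/-- An (extended) base-`b` CP-distribution: the extended version of a restricted one. -/
def IsCP {d : ℕ} (b : ℕ) [NeZero b] (Q : Measure (Radon d × E d)) : Prop :=
  ∃ Q₀ : Measure (Radon d × E d), IsRestrictedCP b Q₀ ∧ IsExtendedVersion b Q₀ Q

/-! ### Centering -/

/-- The discrete centering: the push-forward of `Q` through `(μ, x) ↦ T_x^* μ`. -/
def discreteCentering {d : ℕ} (Q : Measure (Radon d × E d)) : Measure (Radon d) :=
  Q.map (fun p => transStar p.2 p.1)

/-- Normalized Lebesgue measure on `[0, c)`. -/
def unifIco (c : ℝ) : Measure ℝ := (ENNReal.ofReal c)⁻¹ • volume.restrict (Ico 0 c)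

/-- The continuous centering `(1 / log b) ∫_0^{log b} S_t^* (cent_0 Q) dt`. -/
def centering {d : ℕ} (b : ℕ) (Q : Measure (Radon d × E d)) : Measure (Radon d) :=
  (unifIco (Real.log b)).bind (fun t => (discreteCentering Q).map (scaleStar t))

/-! ### Measure-preserving semiflows, suspensions and factors -/

/-- A measure-preserving semiflow `(s_t)_{t ≥ 0}` on a probability space (the action need only be
defined almost everywhere). -/
structure IsMPSemiflow {Ω : Type*} [MeasurableSpace Ω] (P : Measure Ω) (s : ℝ → Ω → Ω) :
    Prop where
  prob : IsProbabilityMeasure P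
  preserving : ∀ t : ℝ, 0 ≤ t → MeasurePreserving (s t) P P
  zero : ∀ᵐ ω ∂P, s 0 ω = ω
  add : ∀ᵐ ω ∂P, ∀ t u : ℝ, 0 ≤ t → 0 ≤ u → s (t + u) ω = s t (s u ω)

/-- The measure of the `c`-suspension of `(Ω, P, f)`; it is carried by `Ω × [0, c)`. -/
def suspMeasure {Ω : Type*} [MeasurableSpace Ω] (c : ℝ) (P : Measure Ω) : Measure (Ω × ℝ) :=
  P.prod (unifIco c)

/-- The `c`-suspension semiflow of `f`, that is, the flow under the constant function `c`:
`s_t (ω, r) = (f^⌊(r+t)/c⌋ ω, c {(r+t)/c})`. -/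
def suspFlow {Ω : Type*} (c : ℝ) (f : Ω → Ω) (t : ℝ) (p : Ω × ℝ) : Ω × ℝ :=
  (f^[⌊(p.2 + t) / c⌋₊] p.1, c * Int.fract ((p.2 + t) / c))

/-- `(P', s')` is a factor of `(P, s)`, as measure-preserving semiflows. -/
def IsFactor {Ω Ω' : Type*} [MeasurableSpace Ω] [MeasurableSpace Ω']
    (P' : Measure Ω') (s' : ℝ → Ω' → Ω') (P : Measure Ω) (s : ℝ → Ω → Ω) : Prop :=
  IsMPSemiflow P' s' ∧ IsMPSemiflow P s ∧
    ∃ π : Ω → Ω', MeasurePreserving π P P' ∧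
      ∀ᵐ ω ∂P, ∀ t : ℝ, 0 ≤ t → π (s t ω) = s' t (π ω)

end CPCentering

end

/-!
Put `π ((μ, x), r) = S_r^* T_x^* μ`. By definition `P = cent Q` is the image under `π` of the
measure of the `log b`-suspension of `(Q, M_b^*)`. Applying `M_b^*` at the point `x` rescales by `b`
up to a translation that `T_x^*` absorbs, so it advances the time `r` by `log b`: the suspension
semiflow is carried by `π` to `(S_t^*)_{t ≥ 0}`, which gives the factor map and the invariance of
`P`.

The extended distribution inherits from the finite stages `ν_n` that, given `μ`, the point `x` has
law `μ|_{B_1}`. Hence an event is null for `P` if and only if, for almost every `(μ, r)` it fails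
for the sceneries `S_r^* T_x^* μ` at `μ`-almost every `x ∈ B_1`, whereas `∫ ⟨μ⟩_U dP(μ)` looks at
the sceneries at the points near `x`. So `P ≪ ∫ ⟨μ⟩_U dP(μ)` because a set that is locally null is
null. Conversely the measure `ν` at time `0` is a magnification of the one at time `-m`, and the
images of `B_1` under these magnifications exhaust `ν` as `m → ∞`; `S_t^*`-invariance for
`t = m log b` therefore extends the sceneries at points of `B_1` to `ν`-almost all points.
-/

namespace CPCentering

open ProbabilityTheory
open scoped ENNReal NNReal

/-! ### Kernels and conditional distributions -/

section Kernels

variable {Ω α β γ : Type*} [MeasurableSpace Ω] [MeasurableSpace α] [MeasurableSpace β]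
  [MeasurableSpace γ]

lemma isSFiniteKernel_of_isFiniteMeasure (κ : Kernel α β) [∀ a, IsFiniteMeasure (κ a)] :
    IsSFiniteKernel κ := by
  classical
  let mass (a : α) : ℕ := ⌊(κ a univ).toReal⌋₊
  have hmass : Measurable mass :=
    Nat.measurable_floor.comp (κ.measurable_coe MeasurableSet.univ).ennreal_toReal
  have hlevel (n : ℕ) : MeasurableSet {a | mass a = n} := hmass (measurableSet_singleton n)
  have hsum : κ = Kernel.sum fun n => Kernel.piecewise (hlevel n) κ 0 := by
    ext a B hB
    rw [Kernel.sum_apply' _ _ hB, tsum_eq_single (mass a)]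
    · simp [Kernel.piecewise_apply]
    · intro n hn
      simp [Kernel.piecewise_apply, hn.symm]
  rw [hsum]
  refine Kernel.isSFiniteKernel_sum (hκs := fun n => ?_)
  have : IsFiniteKernel (Kernel.piecewise (hlevel n) κ 0) := by
    refine ⟨n + 1, by finiteness, fun a => ?_⟩
    rw [Kernel.piecewise_apply]
    split_ifs with ha
    · rw [← ENNReal.ofReal_toReal (measure_ne_top (κ a) univ), ← Nat.cast_add_one,
        ← ENNReal.ofReal_natCast]
      refine ENNReal.ofReal_le_ofReal ?_
      rw [Nat.cast_add_one, ← show mass a = n from ha]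
      exact (Nat.lt_floor_add_one _).le
    · simp
  infer_instance

lemma isSFiniteKernel_of_iUnion_eq_univ (κ : Kernel α β) {S : ℕ → Set β}
    (hS : ∀ n, MeasurableSet (S n)) (hunion : ⋃ n, S n = univ)
    (hfin : ∀ n a, κ a (S n) < ∞) : IsSFiniteKernel κ := by
  have hD : ∀ n, MeasurableSet (disjointed S n) := MeasurableSet.disjointed hS
  have hsum : κ = Kernel.sum fun n => κ.restrict (hD n) := by
    ext1 a
    simp only [Kernel.sum_apply, Kernel.restrict_apply]
    rw [← Measure.restrict_iUnion (disjoint_disjointed S) hD, iUnion_disjointed, hunion,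
      Measure.restrict_univ]
  rw [hsum]
  refine Kernel.isSFiniteKernel_sum (hκs := fun n => ?_)
  have (a : α) : IsFiniteMeasure (κ.restrict (hD n) a) := by
    refine ⟨?_⟩
    rw [Kernel.restrict_apply, Measure.restrict_apply_univ]
    exact (measure_mono (disjointed_subset S n)).trans_lt (hfin n a)
  exact isSFiniteKernel_of_isFiniteMeasure _

variable {P : Measure Ω} {X : Ω → α} {Y : Ω → β} {κ : Kernel α β}

lemma hasCondDistrib_comp_of_measurePreserving {P' : Measure γ} {f : γ → Ω}
    (h : HasCondDistrib Y X κ P) (hf : MeasurePreserving f P' P) (hX : Measurable X)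
    (hY : Measurable Y) : HasCondDistrib (fun a => Y (f a)) (fun a => X (f a)) κ P' := by
  have hXY := hX.prodMk hY
  refine ⟨(hXY.comp hf.measurable).aemeasurable, ?_⟩
  change P'.map ((fun ω => (X ω, Y ω)) ∘ f) = P'.map (X ∘ f) ⊗ₘ κ
  rw [← Measure.map_map hXY hf.measurable, ← Measure.map_map hX hf.measurable, hf.map_eq,
    h.map_eq]

variable [IsSFiniteKernel κ]

lemma measure_inter_of_hasCondDistrib [SFinite P] (h : HasCondDistrib Y X κ P)
    (hX : Measurable X) (hY : Measurable Y) {A : Set α} {B : Set β} (hA : MeasurableSet A)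
    (hB : MeasurableSet B) :
    P (X ⁻¹' A ∩ Y ⁻¹' B) = ∫⁻ ω in X ⁻¹' A, κ (X ω) B ∂P := by
  rw [← mk_preimage_prod, ← Measure.map_apply (hX.prodMk hY) (hA.prod hB), h.map_eq,
    Measure.compProd_apply_prod hA hB, setLIntegral_map hA (κ.measurable_coe hB) hX]

lemma hasCondDistrib_of_measure_inter [IsFiniteMeasure P] (hX : Measurable X)
    (hY : Measurable Y) (h : ∀ A B, MeasurableSet A → MeasurableSet B →
      P (X ⁻¹' A ∩ Y ⁻¹' B) = ∫⁻ ω in X ⁻¹' A, κ (X ω) B ∂P) :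
    HasCondDistrib Y X κ P := by
  refine ⟨(hX.prodMk hY).aemeasurable, Measure.ext_prod fun {A B} hA hB => ?_⟩
  rw [Measure.map_apply (hX.prodMk hY) (hA.prod hB), mk_preimage_prod, h A B hA hB,
    Measure.compProd_apply_prod hA hB, setLIntegral_map hA (κ.measurable_coe hB) hX]

lemma ae_iff_ae_ae_of_hasCondDistrib [SFinite P] (h : HasCondDistrib Y X κ P)
    (hX : Measurable X) (hY : Measurable Y) {s : Set (α × β)} (hs : MeasurableSet s) :
    (∀ᵐ ω ∂P, (X ω, Y ω) ∈ s) ↔ ∀ᵐ ω ∂P, ∀ᵐ y ∂κ (X ω), (X ω, y) ∈ s := by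
  rw [← ae_map_iff (p := (· ∈ s)) (hX.prodMk hY).aemeasurable hs, h.map_eq,
    Measure.ae_compProd_iff (p := (· ∈ s)) hs]
  exact ae_map_iff hX.aemeasurable
    (Kernel.measurable_kernel_prodMk_left hs.compl (measurableSet_singleton 0))

lemma hasCondDistrib_of_ae_eq_const [IsFiniteMeasure P] (hX : Measurable X) (hY : Measurable Y)
    {a : α} (ha : ∀ᵐ ω ∂P, X ω = a) (hmap : P.map Y = P univ • κ a) :
    HasCondDistrib Y X κ P := by
  refine hasCondDistrib_of_measure_inter hX hY fun A B _ hB => ?_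
  have hκ : ∫⁻ ω in X ⁻¹' A, κ (X ω) B ∂P = κ a B * P (X ⁻¹' A) := by
    rw [← setLIntegral_const]
    refine lintegral_congr_ae (ae_restrict_of_ae ?_)
    filter_upwards [ha] with ω hω
    rw [hω]
  rw [hκ]
  by_cases haA : a ∈ A
  · have hA' : X ⁻¹' A =ᵐ[P] univ := by
      filter_upwards [ha] with ω hω
      exact propext ⟨fun _ => trivial, fun _ => show X ω ∈ A by rwa [hω]⟩
    rw [measure_congr hA', measure_congr (hA'.inter (ae_eq_refl (Y ⁻¹' B))), univ_inter,
      ← Measure.map_apply hY hB, hmap, Measure.smul_apply, smul_eq_mul, mul_comm]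
  · have hA' : P (X ⁻¹' A) = 0 := by
      refine measure_mono_null (fun ω hω => ?_) ha
      rintro rfl
      exact haA hω
    rw [hA', mul_zero, measure_mono_null inter_subset_left hA']

lemma hasCondDistrib_of_restrict_fiber [IsFiniteMeasure P] {ι : Type*} [Countable ι]
    [MeasurableSpace ι] [MeasurableSingletonClass ι] {f : Ω → ι} (hf : Measurable f)
    (hX : Measurable X) (hY : Measurable Y)
    (h : ∀ k, P (f ⁻¹' {k}) ≠ 0 → HasCondDistrib Y X κ (P.restrict (f ⁻¹' {k}))) :
    HasCondDistrib Y X κ P := by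
  refine hasCondDistrib_of_measure_inter hX hY fun A B hA hB => ?_
  have hfiber (k : ι) : MeasurableSet (f ⁻¹' {k}) := hf (measurableSet_singleton k)
  have hP : P = Measure.sum fun k => P.restrict (f ⁻¹' {k}) := by
    rw [← Measure.restrict_iUnion (pairwise_disjoint_fiber f) hfiber, ← preimage_iUnion,
      iUnion_of_singleton, preimage_univ, Measure.restrict_univ]
  rw [hP, Measure.sum_apply _ ((hX hA).inter (hY hB)), Measure.restrict_sum _ (hX hA),
    lintegral_sum_measure]
  refine tsum_congr fun k => ?_
  by_cases hk : P (f ⁻¹' {k}) = 0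
  · simp [Measure.restrict_eq_zero.mpr hk]
  · exact measure_inter_of_hasCondDistrib (h k hk) hX hY hA hB

lemma hasCondDistrib_compProd {m : Measure Ω} [SFinite m] {η : Kernel Ω γ} [IsSFiniteKernel η]
    [IsFiniteMeasure (m ⊗ₘ η)] {X : Ω × γ → α} {Y : Ω × γ → β} (hX : Measurable X)
    (hY : Measurable Y)
    (h : ∀ᵐ ω ∂m, HasCondDistrib (fun x => Y (ω, x)) (fun x => X (ω, x)) κ (η ω)) :
    HasCondDistrib Y X κ (m ⊗ₘ η) := by
  refine hasCondDistrib_of_measure_inter hX hY fun A B hA hB => ?_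
  have hmeas : Measurable ((X ⁻¹' A).indicator fun p => κ (X p) B) :=
    ((κ.measurable_coe hB).comp hX).indicator (hX hA)
  rw [Measure.compProd_apply ((hX hA).inter (hY hB)), ← lintegral_indicator (hX hA),
    Measure.lintegral_compProd hmeas]
  refine lintegral_congr_ae ?_
  filter_upwards [h] with ω hω
  have hA' : MeasurableSet ((fun x => X (ω, x)) ⁻¹' A) := measurable_prodMk_left (hX hA)
  refine (measure_inter_of_hasCondDistrib hω (hX.comp measurable_prodMk_left)
    (hY.comp measurable_prodMk_left) hA hB).trans ?_
  rw [← lintegral_indicator hA']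
  rfl

lemma hasCondDistrib_prod [IsFiniteMeasure P] {m : Measure γ} [IsFiniteMeasure m]
    (h : HasCondDistrib Y X κ P) (hX : Measurable X) (hY : Measurable Y) :
    HasCondDistrib (fun q : Ω × γ => Y q.1) (fun q => (X q.1, q.2)) (κ.prodMkRight γ)
      (P.prod m) := by
  have hfiber (c : γ) : HasCondDistrib Y (fun ω => (X ω, c)) (κ.prodMkRight γ) P :=
    hasCondDistrib_of_measure_inter (hX.prodMk measurable_const) hY fun A B hA hB =>
      measure_inter_of_hasCondDistrib h hX hY (measurable_prodMk_right hA) hB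
  have hX' : Measurable fun q : γ × Ω => (X q.2, q.1) :=
    (hX.comp measurable_snd).prodMk measurable_fst
  have hY' : Measurable fun q : γ × Ω => Y q.2 := hY.comp measurable_snd
  have hprod : HasCondDistrib (fun q : γ × Ω => Y q.2) (fun q => (X q.2, q.1))
      (κ.prodMkRight γ) (m.prod P) := by
    rw [← Measure.compProd_const]
    exact hasCondDistrib_compProd hX' hY' (Eventually.of_forall hfiber)
  exact hasCondDistrib_comp_of_measurePreserving hprod Measure.measurePreserving_swap hX' hY'

end Kernels

/-! ### Almost everywhere limits -/

section Limits

variable {Ω α : Type*} [MeasurableSpace Ω] [MeasurableSpace α]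

lemma ae_measure_fiber_ne_zero {ι : Type*} [Countable ι] (μ : Measure α) (f : α → ι) :
    ∀ᵐ x ∂μ, μ (f ⁻¹' {f x}) ≠ 0 := by
  have h : ∀ᵐ x ∂μ, ∀ k, μ (f ⁻¹' {k}) = 0 → f x ≠ k := by
    refine ae_all_iff.mpr fun k => ?_
    by_cases hk : μ (f ⁻¹' {k}) = 0
    · filter_upwards [measure_eq_zero_iff_ae_notMem.mp hk] with x hx _ using hx
    · exact Eventually.of_forall fun x h0 => absurd h0 hk
  filter_upwards [h] with x hx h0 using hx _ h0 rfl

variable [TopologicalSpace α] [BorelSpace α]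

lemma tendsto_lintegral_map_of_ae_tendsto {L : Measure Ω} [IsFiniteMeasure L] {g : ℕ → Ω → α}
    {g' : Ω → α} (hg : ∀ n, Measurable (g n)) (hg' : Measurable g')
    (h : ∀ᵐ ω ∂L, Tendsto (fun n => g n ω) atTop (𝓝 (g' ω)))
    (f : BoundedContinuousFunction α ℝ≥0) :
    Tendsto (fun n => ∫⁻ x, f x ∂(L.map (g n))) atTop (𝓝 (∫⁻ x, f x ∂(L.map g'))) := by
  have hf : Measurable fun x => (f x : ℝ≥0∞) := f.continuous.measurable.coe_nnreal_ennreal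
  simp only [lintegral_map hf (hg _), lintegral_map hf hg']
  refine tendsto_lintegral_of_dominated_convergence (fun _ => (nndist 0 f : ℝ≥0∞))
    (fun n => hf.comp (hg n))
    (fun n => Eventually.of_forall fun ω => ENNReal.coe_le_coe.mpr (f.apply_le_nndist_zero _))
    ?_ ?_
  · rw [lintegral_const]
    exact ENNReal.mul_ne_top ENNReal.coe_ne_top (measure_ne_top _ _)
  · filter_upwards [h] with ω hω
    exact ENNReal.tendsto_coe.mpr ((f.continuous.tendsto _).comp hω)

lemma map_eq_of_ae_tendsto [HasOuterApproxClosed α] {L₁ L₂ : Measure Ω} [IsFiniteMeasure L₁]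
    [IsFiniteMeasure L₂] {g : ℕ → Ω → α} {g' : Ω → α} (hg : ∀ n, Measurable (g n))
    (hg' : Measurable g') (h₁ : ∀ᵐ ω ∂L₁, Tendsto (fun n => g n ω) atTop (𝓝 (g' ω)))
    (h₂ : ∀ᵐ ω ∂L₂, Tendsto (fun n => g n ω) atTop (𝓝 (g' ω)))
    (h : ∀ n, L₁.map (g n) = L₂.map (g n)) : L₁.map g' = L₂.map g' := by
  refine ext_of_forall_lintegral_eq_of_IsFiniteMeasure fun f => ?_
  refine tendsto_nhds_unique (tendsto_lintegral_map_of_ae_tendsto hg hg' h₁ f) ?_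
  simp only [h]
  exact tendsto_lintegral_map_of_ae_tendsto hg hg' h₂ f

end Limits

/-! ### Measure-preserving maps -/

section MeasurePreserving

variable {α β : Type*} [MeasurableSpace α] [MeasurableSpace β] {μ : Measure α} {ν : Measure β}

lemma measurePreserving_of_ae_semiconj {π : α → β} {f : α → α} {g : β → β}
    (hπ : MeasurePreserving π μ ν) (hf : MeasurePreserving f μ μ) (hg : Measurable g)
    (h : ∀ᵐ a ∂μ, π (f a) = g (π a)) : MeasurePreserving g ν ν := by
  refine ⟨hg, ?_⟩
  calc ν.map g = μ.map (g ∘ π) := by rw [← hπ.map_eq, Measure.map_map hg hπ.measurable]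
    _ = μ.map (π ∘ f) := Measure.map_congr (h.mono fun _ ha => ha.symm)
    _ = ν := (hπ.comp hf).map_eq

lemma measurePreserving_of_ae_leftInverse {f : α → β} {g : β → α}
    (hf : MeasurePreserving f μ ν) (hg : Measurable g) (h : ∀ᵐ a ∂μ, g (f a) = a) :
    MeasurePreserving g ν μ := by
  refine ⟨hg, ?_⟩
  rw [← hf.map_eq, Measure.map_map hg hf.measurable]
  exact (Measure.map_congr h).trans Measure.map_id

end MeasurePreserving

/-! ### Radon measures -/

variable {d : ℕ}

lemma measurableSet_B1 : MeasurableSet (B1 d) := Metric.isClosed_closedBall.measurableSet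

lemma measure_lt_top_of_isCompact (μ : Radon d) {K : Set (E d)} (hK : IsCompact K) :
    μ.1 K < ∞ :=
  haveI := μ.2
  hK.measure_lt_top

lemma measure_preimage_B1_lt_top (f : E d ≃ₜ E d) (μ : Radon d) : μ.1 (f ⁻¹' B1 d) < ∞ :=
  measure_lt_top_of_isCompact μ (f.isCompact_preimage.mpr (isCompact_closedBall _ _))

lemma measure_B1_lt_top (μ : Radon d) : μ.1 (B1 d) < ∞ :=
  measure_lt_top_of_isCompact μ (isCompact_closedBall _ _)

lemma star_apply (μ : Radon d) (A : Set (E d)) :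
    (star μ).1 A = ((μ.1 (B1 d)).toNNReal⁻¹ : ℝ≥0) * μ.1 A := rfl

lemma push_apply (f : E d ≃ₜ E d) (μ : Radon d) (A : Set (E d)) :
    (push f μ).1 A = μ.1 (f ⁻¹' A) :=
  f.toMeasurableEquiv.map_apply A

lemma box_apply (μ : Radon d) {A : Set (E d)} (hA : MeasurableSet A) :
    (box μ).1 A = (star μ).1 (A ∩ B1 d) :=
  Measure.restrict_apply hA

lemma push_refl (μ : Radon d) : push (Homeomorph.refl _) μ = μ :=
  Subtype.ext Measure.map_id

lemma push_push (f g : E d ≃ₜ E d) (μ : Radon d) : push g (push f μ) = push (f.trans g) μ :=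
  Subtype.ext (Measure.map_map g.measurable f.measurable)

lemma star_eq_self {μ : Radon d} (h : μ ∈ MStar d) : star μ = μ := by
  refine Subtype.ext (Measure.ext fun A _ => ?_)
  rw [star_apply, show μ.1 (B1 d) = 1 from h]
  simp

lemma star_mem_MStar {μ : Radon d} (h : μ.1 (B1 d) ≠ 0) : star μ ∈ MStar d := by
  have hfin := (measure_B1_lt_top μ).ne
  change (star μ).1 (B1 d) = 1
  rw [star_apply, ENNReal.coe_inv (ENNReal.toNNReal_ne_zero.mpr ⟨h, hfin⟩),
    ENNReal.coe_toNNReal hfin, ENNReal.inv_mul_cancel h hfin]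

lemma star_apply_eq_zero_iff {μ : Radon d} (h : μ.1 (B1 d) ≠ 0) (A : Set (E d)) :
    (star μ).1 A = 0 ↔ μ.1 A = 0 := by
  rw [star_apply, mul_eq_zero, or_iff_right]
  simp [ENNReal.toNNReal_eq_zero_iff, h, (measure_B1_lt_top μ).ne]

lemma star_push_star (f : E d ≃ₜ E d) {μ : Radon d}
    (h : μ.1 (B1 d) = 0 → μ.1 (f ⁻¹' B1 d) = 0) :
    star (push f (star μ)) = star (push f μ) := by
  refine Subtype.ext (Measure.ext fun A _ => ?_)
  simp only [star_apply, push_apply]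
  by_cases h0 : μ.1 (f ⁻¹' B1 d) = 0
  · simp [h0]
  · have hm : (μ.1 (B1 d)).toNNReal ≠ 0 :=
      ENNReal.toNNReal_ne_zero.mpr ⟨mt h h0, (measure_B1_lt_top μ).ne⟩
    rw [ENNReal.toNNReal_mul, ENNReal.toNNReal_coe, ← mul_assoc, ← ENNReal.coe_mul]
    congr 2
    field_simp

lemma box_eq_self {μ : Radon d} (h : μ ∈ MBox d) : box μ = μ := by
  rw [box, ← Subtype.coe_inj]
  simp only [star_eq_self (show μ ∈ MStar d from h.1)]
  exact Measure.restrict_eq_self_of_ae_mem h.2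

lemma box_push_box (g : E d ≃ₜ E d) (hg : g ⁻¹' B1 d ⊆ B1 d) {μ : Radon d}
    (h : μ.1 (B1 d) ≠ 0) : box (push g (box μ)) = box (push g μ) := by
  have hlocal (A : Set (E d)) (hA : MeasurableSet A) (hA' : A ⊆ B1 d) :
      (push g (box μ)).1 A = (push g (star μ)).1 A := by
    rw [push_apply, push_apply, box_apply _ (g.measurable hA),
      inter_eq_left.mpr ((preimage_mono hA').trans hg)]
  have hstar : box (push g (star μ)) = box (push g μ) := by
    rw [box, box]
    simp only [star_push_star g fun h0 => absurd h0 h]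
  refine Subtype.ext (Measure.ext fun A hA => ?_)
  rw [← hstar, box_apply _ hA, box_apply _ hA, star_apply, star_apply,
    hlocal _ measurableSet_B1 Subset.rfl, hlocal _ (hA.inter measurableSet_B1) inter_subset_right]

/-! ### Measurability -/

/-- The tautological kernel from `𝓜` to `ℝ^d`, which sends a Radon measure to itself. -/
noncomputable def radonKernel (d : ℕ) : Kernel (Radon d) (E d) :=
  ⟨Subtype.val, measurable_subtype_coe⟩

instance isSFiniteKernel_radonKernel : IsSFiniteKernel (radonKernel d) :=
  isSFiniteKernel_of_iUnion_eq_univ (radonKernel d)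
    (fun _ => Metric.isClosed_closedBall.measurableSet) (Metric.iUnion_closedBall_nat (0 : E d))
    fun n μ => measure_lt_top_of_isCompact μ (isCompact_closedBall 0 (n : ℝ))

/-- The kernel `μ ↦ μ|_{B_1}`. Its values are the conditional distributions in the adaptedness of
an extended CP-distribution, whose measures are not carried by `B_1`. -/
noncomputable def ballKernel (d : ℕ) : Kernel (Radon d) (E d) :=
  (radonKernel d).restrict measurableSet_B1

lemma ballKernel_apply (μ : Radon d) : ballKernel d μ = μ.1.restrict (B1 d) := rfl

instance isSFiniteKernel_ballKernel : IsSFiniteKernel (ballKernel d) := by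
  unfold ballKernel
  infer_instance

variable {α : Type*} [MeasurableSpace α]

lemma measurable_apply {A : Set (E d)} (hA : MeasurableSet A) :
    Measurable fun μ : Radon d => μ.1 A :=
  (radonKernel d).measurable_coe hA

lemma measurable_measure_section {m : α → Radon d} (hm : Measurable m) {S : Set (α × E d)}
    (hS : MeasurableSet S) : Measurable fun a => (m a).1 (Prod.mk a ⁻¹' S) :=
  Kernel.measurable_kernel_prodMk_left (κ := (radonKernel d).comap m hm) hS

lemma measurableSet_ae_section {m : α → Radon d} (hm : Measurable m) {S : Set (α × E d)}
    (hS : MeasurableSet S) : MeasurableSet {a | ∀ᵐ y ∂(m a).1, (a, y) ∈ S} :=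
  (measurable_measure_section hm hS.compl) (measurableSet_singleton 0)

lemma measurable_radon_iff {m : α → Radon d} :
    Measurable m ↔ ∀ A : Set (E d), MeasurableSet A → Measurable fun a => (m a).1 A :=
  ⟨fun h _ hA => (measurable_apply hA).comp h,
    fun h => (Measure.measurable_of_measurable_coe _ h).subtype_mk⟩

lemma measurable_push {h : α → E d ≃ₜ E d} (hh : Measurable fun p : α × E d => h p.1 p.2)
    {m : α → Radon d} (hm : Measurable m) : Measurable fun a => push (h a) (m a) := by
  refine measurable_radon_iff.mpr fun A hA => ?_
  simp only [push_apply]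
  exact measurable_measure_section hm (hh hA)

lemma measurable_star : Measurable (star : Radon d → Radon d) := by
  refine measurable_radon_iff.mpr fun A hA => ?_
  simp only [star_apply]
  exact ((measurable_apply measurableSet_B1).ennreal_toNNReal.inv.coe_nnreal_ennreal).mul
    (measurable_apply hA)

lemma measurable_transStar {x : α → E d} (hx : Measurable x) {m : α → Radon d}
    (hm : Measurable m) : Measurable fun a => transStar (x a) (m a) := by
  refine measurable_star.comp (measurable_push (h := fun a => trans (x a)) ?_ hm)
  exact measurable_snd.sub (hx.comp measurable_fst)

lemma measurable_scaleStar {t : α → ℝ} (ht : Measurable t) {m : α → Radon d}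
    (hm : Measurable m) : Measurable fun a => scaleStar (t a) (m a) := by
  refine measurable_star.comp (measurable_push (h := fun a => scale (t a)) ?_ hm)
  exact (Real.measurable_exp.comp (ht.comp measurable_fst)).smul measurable_snd

lemma measurableSet_mem_support :
    MeasurableSet {p : Radon d × E d | p.2 ∈ p.1.1.support} := by
  have hball (r : ℝ) : MeasurableSet {p : Radon d × E d | p.1.1 (Metric.closedBall p.2 r) ≠ 0} := by
    have h : MeasurableSet {q : (Radon d × E d) × E d | dist q.2 q.1.2 ≤ r} :=
      measurableSet_le (measurable_snd.dist (measurable_snd.comp measurable_fst))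
        measurable_const
    exact (measurable_measure_section measurable_fst h) (measurableSet_singleton 0).compl
  have hsupport : {p : Radon d × E d | p.2 ∈ p.1.1.support} =
      ⋂ n : ℕ, {p | p.1.1 (Metric.closedBall p.2 (1 / ((n : ℝ) + 1))) ≠ 0} := by
    ext p
    rw [mem_iInter, mem_ofPred_eq,
      Metric.nhds_basis_closedBall_inv_nat_succ.mem_measureSupport]
    simp [pos_iff_ne_zero]
  rw [hsupport]
  exact MeasurableSet.iInter fun n => hball _

/-! ### Scalings -/

lemma scale_preimage_B1 (t : ℝ) :
    (scale t : E d ≃ₜ E d) ⁻¹' B1 d = Metric.closedBall 0 (Real.exp (-t)) := by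
  ext y
  simp only [mem_preimage, B1, Metric.mem_closedBall, dist_zero_right]
  change ‖Real.exp t • y‖ ≤ 1 ↔ _
  rw [norm_smul, Real.norm_eq_abs, Real.abs_exp, Real.exp_neg, ← one_div,
    le_div_iff₀' (Real.exp_pos t)]

lemma scale_trans_scale (t u : ℝ) :
    (scale u : E d ≃ₜ E d).trans (scale t) = scale (t + u) := by
  ext y : 1
  change Real.exp t • Real.exp u • y = Real.exp (t + u) • y
  rw [smul_smul, Real.exp_add]

lemma scale_zero : (scale 0 : E d ≃ₜ E d) = Homeomorph.refl _ := by
  ext y : 1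
  change Real.exp 0 • y = y
  simp

lemma scaleStar_zero (μ : Radon d) : scaleStar 0 μ = star μ := by
  rw [scaleStar, scale_zero, push_refl]

lemma scaleStar_scaleStar (t u : ℝ) {μ : Radon d}
    (h : μ.1 (Metric.closedBall 0 (Real.exp (-u))) = 0 →
      μ.1 (Metric.closedBall 0 (Real.exp (-(t + u)))) = 0) :
    scaleStar t (scaleStar u μ) = scaleStar (t + u) μ := by
  have hcomp : (scale t : E d → E d) ∘ scale u = scale (t + u) := by
    rw [← scale_trans_scale]
    rfl
  rw [scaleStar, scaleStar, star_push_star, push_push, scale_trans_scale, scaleStar]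
  rwa [push_apply, push_apply, ← preimage_comp, hcomp, scale_preimage_B1, scale_preimage_B1]

lemma scaleStar_scaleStar_of_nonneg {t : ℝ} (ht : 0 ≤ t) (u : ℝ) (μ : Radon d) :
    scaleStar t (scaleStar u μ) = scaleStar (t + u) μ :=
  scaleStar_scaleStar t u <| measure_mono_null <|
    Metric.closedBall_subset_closedBall (Real.exp_le_exp.mpr (by linarith))

/-! ### Cells -/

/-- The half-open cube `[-1,1)^d`, onto which `T_{𝓓_b(x)}` maps the cell `𝓓_b(x)`. -/
def halfCube (d : ℕ) : Set (E d) := {x | ∀ i, -1 ≤ x i ∧ x i < 1}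

lemma measurableSet_halfCube : MeasurableSet (halfCube d) := by
  simp only [halfCube, ofPred_forall]
  exact MeasurableSet.iInter fun i => measurable_pi_apply i measurableSet_Ico

lemma mem_B1_iff {x : E d} : x ∈ B1 d ↔ ∀ i, -1 ≤ x i ∧ x i ≤ 1 := by
  rw [B1, mem_closedBall_zero_iff, pi_norm_le_iff_of_nonneg zero_le_one]
  simp [Real.norm_eq_abs, abs_le]

lemma halfCube_subset_B1 : halfCube d ⊆ B1 d := fun _ hx =>
  mem_B1_iff.mpr fun i => ⟨(hx i).1, (hx i).2.le⟩

lemma measurable_cellIndex (b : ℕ) : Measurable (cellIndex (d := d) b) := by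
  refine measurable_pi_lambda _ fun i => ?_
  have hfloor : Measurable fun x : E d => ⌊((b : ℝ) * x i + b) / 2⌋ :=
    Int.measurable_floor.comp
      ((((measurable_pi_apply i).const_mul _).add_const _).div_const _)
  exact (measurable_from_top (f := fun n : ℤ => 2 * n - (b : ℤ))).comp hfloor

lemma measurable_cellCenter (b : ℕ) : Measurable (cellCenter (d := d) b) := by
  refine measurable_pi_lambda _ fun i => ?_
  have hindex : Measurable fun x : E d => cellIndex b x i :=
    (measurable_pi_apply i).comp (measurable_cellIndex b)
  exact (measurable_from_top (f := fun n : ℤ => ((n : ℝ) + 1) / b)).comp hindex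

section Cells

variable (b : ℕ) [NeZero b]

lemma cellHomothety_apply (x y : E d) :
    cellHomothety b x y = (b : ℝ) • (y - cellCenter b x) := rfl

lemma cellHomothety_apply_coord (x y : E d) (i : Fin d) :
    cellHomothety b x y i = b * y i + b - 2 * ⌊((b : ℝ) * x i + b) / 2⌋ - 1 := by
  have hb : (b : ℝ) ≠ 0 := Nat.cast_ne_zero.mpr (NeZero.ne b)
  rw [cellHomothety_apply]
  simp only [Pi.smul_apply, Pi.sub_apply, smul_eq_mul, cellCenter, cellIndex]
  push_cast
  field_simp
  ring

lemma cellHomothety_congr {x y : E d} (h : cellIndex b x = cellIndex b y) :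
    cellHomothety b x = cellHomothety b y := by
  have hcenter : cellCenter b x = cellCenter b y := by
    funext i
    simp only [cellCenter, h]
  rw [cellHomothety, cellHomothety, hcenter]

lemma cellHomothety_preimage_halfCube (x : E d) :
    cellHomothety b x ⁻¹' halfCube d = cellIndex b ⁻¹' {cellIndex b x} := by
  ext y
  have hindex : cellIndex b y = cellIndex b x ↔
      ∀ i, ⌊((b : ℝ) * y i + b) / 2⌋ = ⌊((b : ℝ) * x i + b) / 2⌋ := by
    simp [funext_iff, cellIndex]
  rw [mem_preimage, mem_preimage, mem_singleton_iff, hindex]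
  simp only [halfCube, mem_ofPred_eq, cellHomothety_apply_coord, Int.floor_eq_iff]
  refine forall_congr' fun i => ?_
  constructor <;> rintro ⟨h1, h2⟩ <;> constructor <;> linarith

lemma cellHomothety_self_mem (x : E d) : cellHomothety b x x ∈ halfCube d := by
  change x ∈ cellHomothety b x ⁻¹' halfCube d
  rw [cellHomothety_preimage_halfCube]
  rfl

lemma cellHomothety_preimage_B1_subset {x : E d} (hx : x ∈ halfCube d) :
    cellHomothety b x ⁻¹' B1 d ⊆ B1 d := by
  intro y hy
  have hb : (0 : ℝ) < b := Nat.cast_pos.mpr (Nat.pos_of_neZero b)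
  rw [mem_preimage, mem_B1_iff] at hy
  refine mem_B1_iff.mpr fun i => ?_
  obtain ⟨hy1, hy2⟩ := hy i
  obtain ⟨hx1, hx2⟩ := hx i
  rw [cellHomothety_apply_coord] at hy1 hy2
  have hfloor_nonneg : (0 : ℝ) ≤ ⌊((b : ℝ) * x i + b) / 2⌋ := by
    exact_mod_cast Int.floor_nonneg.mpr (by nlinarith)
  have hfloor_lt : (⌊((b : ℝ) * x i + b) / 2⌋ : ℝ) + 1 ≤ b := by
    have : ⌊((b : ℝ) * x i + b) / 2⌋ < (b : ℤ) := by
      rw [Int.floor_lt, Int.cast_natCast]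
      nlinarith
    exact_mod_cast this
  constructor <;> nlinarith

variable {b}

lemma cellHomothety_eq_refl {x : E d} (hx : x ∈ halfCube d) (hb : b = 1) :
    cellHomothety b x = Homeomorph.refl _ := by
  subst hb
  ext y i
  have hfloor : ⌊(((1 : ℕ) : ℝ) * x i + (1 : ℕ)) / 2⌋ = 0 := by
    obtain ⟨h1, h2⟩ := hx i
    rw [Int.floor_eq_zero_iff]
    push_cast
    constructor <;> linarith
  rw [cellHomothety_apply_coord, hfloor]
  simp

lemma cellHomothety_trans_cellHomothety {c e : ℕ} [NeZero c] [NeZero e] (he : e = b * c)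
    (x : E d) :
    (cellHomothety b x).trans (cellHomothety c (cellHomothety b x x)) = cellHomothety e x := by
  subst he
  ext y i
  rw [Homeomorph.trans_apply]
  simp only [cellHomothety_apply_coord]
  have h : ((c : ℝ) * (b * x i + b - 2 * ⌊((b : ℝ) * x i + b) / 2⌋ - 1) + c) / 2
      = (((b * c : ℕ) : ℝ) * x i + (b * c : ℕ)) / 2
        - ((c * ⌊((b : ℝ) * x i + b) / 2⌋ : ℤ) : ℝ) := by
    push_cast
    ring
  rw [h, Int.floor_sub_intCast]
  push_cast
  ring

lemma cellHomothety_cellHomothety {c e : ℕ} [NeZero c] [NeZero e] (he : e = b * c) (x y : E d) :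
    cellHomothety c (cellHomothety b x x) (cellHomothety b x y) = cellHomothety e x y := by
  rw [← cellHomothety_trans_cellHomothety he]
  rfl

/-- The map `(μ, x) ↦ T_{𝓓_b(x)}^* μ`, the first component of `M_b^*`. -/
noncomputable def cellStar (b : ℕ) [NeZero b] (p : Radon d × E d) : Radon d :=
  star (push (cellHomothety b p.2) p.1)

lemma cellStar_congr {μ : Radon d} {x y : E d} (h : cellIndex b x = cellIndex b y) :
    cellStar b (μ, x) = cellStar b (μ, y) := by
  simp only [cellStar, cellHomothety_congr b h]

variable (b)

lemma measurable_cellHomothety_self : Measurable fun x : E d => cellHomothety b x x := by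
  simp only [cellHomothety_apply]
  exact (measurable_id.sub (measurable_cellCenter b)).const_smul (b : ℝ)

lemma measurable_push_cellHomothety :
    Measurable fun p : Radon d × E d => push (cellHomothety b p.2) p.1 := by
  refine measurable_push (h := fun p : Radon d × E d => cellHomothety b p.2) ?_ measurable_fst
  simp only [cellHomothety_apply]
  exact (measurable_snd.sub ((measurable_cellCenter b).comp
    (measurable_snd.comp measurable_fst))).const_smul (b : ℝ)

lemma measurable_measure_cellHomothety_preimage {A : Set (E d)} (hA : MeasurableSet A) :
    Measurable fun p : Radon d × E d => p.1.1 (cellHomothety b p.2 ⁻¹' A) := by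
  simpa only [Function.comp_def, push_apply] using
    (measurable_apply hA).comp (measurable_push_cellHomothety b)

lemma measurable_cellStar : Measurable (cellStar (d := d) b) :=
  measurable_star.comp (measurable_push_cellHomothety b)

lemma measurable_magStar : Measurable (magStar (d := d) b) :=
  (measurable_cellStar b).prodMk ((measurable_cellHomothety_self b).comp measurable_snd)

variable {b}

lemma magBox_magBox_pow {n : ℕ} {p : Radon d × E d}
    (h : p.1.1 (cellHomothety (b ^ n) p.2 ⁻¹' B1 d) ≠ 0) :
    magBox b (magBox (b ^ n) p) = magBox (b ^ (n + 1)) p := by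
  refine Prod.ext ?_ (cellHomothety_cellHomothety (pow_succ b n) p.2 p.2)
  change box (push (cellHomothety b (cellHomothety (b ^ n) p.2 p.2))
    (box (push (cellHomothety (b ^ n) p.2) p.1))) = box (push (cellHomothety (b ^ (n + 1)) p.2) p.1)
  rw [box_push_box _ (cellHomothety_preimage_B1_subset b (cellHomothety_self_mem _ _))
    (by rwa [push_apply]), push_push, cellHomothety_trans_cellHomothety (pow_succ b n)]

lemma iterate_magBox {p : Radon d × E d} (hμ : p.1 ∈ MBox d) (hx : p.2 ∈ halfCube d)
    (hcell : ∀ n, p.1.1 (cellHomothety (b ^ n) p.2 ⁻¹' B1 d) ≠ 0) (n : ℕ) :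
    (magBox b)^[n] p = magBox (b ^ n) p := by
  induction n with
  | zero =>
    simp only [Function.iterate_zero, id_eq, magBox, cellHomothety_eq_refl hx (pow_zero b),
      push_refl, box_eq_self hμ]
    rfl
  | succ n ih => rw [Function.iterate_succ_apply', ih, magBox_magBox_pow (hcell n)]

end Cells

/-! ### Restricted CP-distributions -/

namespace IsRestrictedCP

variable {b : ℕ} [NeZero b] {Q₀ : Measure (Radon d × E d)}

lemma hasCondDistrib (h : IsRestrictedCP b Q₀) :
    HasCondDistrib Prod.snd Prod.fst (radonKernel d) Q₀ := by
  have := h.prob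
  refine hasCondDistrib_of_measure_inter measurable_fst measurable_snd fun A B hA hB => ?_
  rw [← Set.prod_eq, h.adapted A B hA hB, prod_univ]
  rfl

lemma eq_compProd (h : IsRestrictedCP b Q₀) : Q₀ = Q₀.fst ⊗ₘ radonKernel d :=
  Measure.map_id.symm.trans h.hasCondDistrib.map_eq

lemma ae_mem_iff (h : IsRestrictedCP b Q₀) {s : Set (Radon d × E d)} (hs : MeasurableSet s) :
    (∀ᵐ p ∂Q₀, p ∈ s) ↔ ∀ᵐ p ∂Q₀, ∀ᵐ x ∂p.1.1, (p.1, x) ∈ s :=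
  have := h.prob
  ae_iff_ae_ae_of_hasCondDistrib h.hasCondDistrib measurable_fst measurable_snd hs

lemma ae_snd_mem (h : IsRestrictedCP b Q₀) : ∀ᵐ p ∂Q₀, p.2 ∈ halfCube d := by
  rw [← h.invariant.map_eq, ae_map_iff h.invariant.measurable.aemeasurable
    (measurable_snd measurableSet_halfCube)]
  exact Eventually.of_forall fun p => cellHomothety_self_mem b p.2

lemma ae_fst_compl_halfCube (h : IsRestrictedCP b Q₀) : ∀ᵐ p ∂Q₀, p.1.1 (halfCube d)ᶜ = 0 :=
  (h.ae_mem_iff (measurable_snd measurableSet_halfCube)).mp h.ae_snd_mem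

lemma ae_mem_support (h : IsRestrictedCP b Q₀) : ∀ᵐ p ∂Q₀, p.2 ∈ p.1.1.support :=
  (h.ae_mem_iff measurableSet_mem_support).mpr
    (Eventually.of_forall fun p => p.1.1.support_mem_ae)

lemma ae_preimage_B1_ne_zero (h : IsRestrictedCP b Q₀) :
    ∀ᵐ p ∂Q₀, ∀ n : ℕ, p.1.1 (cellHomothety (b ^ n) p.2 ⁻¹' B1 d) ≠ 0 := by
  refine ae_all_iff.mpr fun n => (h.ae_mem_iff
    (measurable_measure_cellHomothety_preimage (b ^ n) measurableSet_B1
      (measurableSet_singleton 0).compl)).mpr (Eventually.of_forall fun p => ?_)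
  filter_upwards [ae_measure_fiber_ne_zero p.1.1 (cellIndex (b ^ n))] with x hx
  rw [← cellHomothety_preimage_halfCube] at hx
  exact fun h0 => hx (measure_mono_null (preimage_mono halfCube_subset_B1) h0)

lemma ae_iterate (h : IsRestrictedCP b Q₀) :
    ∀ᵐ p ∂Q₀, ∀ n : ℕ, (magBox b)^[n] p = magBox (b ^ n) p := by
  filter_upwards [h.mem, h.ae_snd_mem, h.ae_preimage_B1_ne_zero] with p hmem hsnd hcell
  exact iterate_magBox hmem.1 hsnd hcell

-- Stationarity transfers `ae_fst_compl_halfCube`, which concerns `μ_0` only, to the cells of all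
-- generations: their upper faces are `μ_0`-null.
lemma ae_boundary (h : IsRestrictedCP b Q₀) (n : ℕ) :
    ∀ᵐ p ∂Q₀, p.1.1 (cellHomothety (b ^ n) p.2 ⁻¹' (B1 d \ halfCube d)) = 0 := by
  filter_upwards [(h.invariant.iterate n).quasiMeasurePreserving.ae h.ae_fst_compl_halfCube,
    h.ae_iterate, h.ae_preimage_B1_ne_zero] with p hcompl hiter hcell
  rw [hiter n] at hcompl
  change (box (push (cellHomothety (b ^ n) p.2) p.1)).1 _ = 0 at hcompl
  rwa [box_apply _ measurableSet_halfCube.compl, star_apply_eq_zero_iff, push_apply,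
    inter_comm] at hcompl
  rw [push_apply]
  exact hcell n

end IsRestrictedCP

/-! ### Adaptedness at finite stages -/

lemma measure_preimage_smul_ballKernel_star_push (f : E d ≃ₜ E d) (μ : Radon d) :
    μ.1 (f ⁻¹' B1 d) • ballKernel d (star (push f μ)) = (μ.1.restrict (f ⁻¹' B1 d)).map f := by
  ext B hB
  have hfin := (measure_preimage_B1_lt_top f μ).ne
  rw [Measure.smul_apply, ballKernel_apply, Measure.restrict_apply hB, star_apply, push_apply,
    push_apply, Measure.map_apply f.measurable hB, Measure.restrict_apply (f.measurable hB),
    smul_eq_mul, ← mul_assoc, preimage_inter]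
  by_cases h0 : μ.1 (f ⁻¹' B1 d) = 0
  · rw [measure_mono_null inter_subset_right h0, mul_zero]
  · rw [ENNReal.coe_inv (ENNReal.toNNReal_ne_zero.mpr ⟨h0, hfin⟩), ENNReal.coe_toNNReal hfin,
      ENNReal.mul_inv_cancel h0 hfin, one_mul]

lemma hasCondDistrib_cellStar_of_ae_boundary (c : ℕ) [NeZero c] {μ : Radon d}
    [IsFiniteMeasure μ.1]
    (hμ : ∀ᵐ x ∂μ.1, μ.1 (cellHomothety c x ⁻¹' (B1 d \ halfCube d)) = 0) :
    HasCondDistrib (fun x => cellHomothety c x x) (fun x => cellStar c (μ, x)) (ballKernel d)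
      μ.1 := by
  have hX : Measurable fun x => cellStar c (μ, x) :=
    (measurable_cellStar c).comp measurable_prodMk_left
  have hY : Measurable fun x : E d => cellHomothety c x x := measurable_cellHomothety_self c
  refine hasCondDistrib_of_restrict_fiber (measurable_cellIndex c) hX hY fun k hk => ?_
  obtain ⟨x₀, hindex, hboundary⟩ : ∃ x₀, cellIndex c x₀ = k ∧
      μ.1 (cellHomothety c x₀ ⁻¹' (B1 d \ halfCube d)) = 0 := by
    by_contra! hcon
    exact hk (measure_mono_null hcon hμ)
  subst hindex
  have hfiber : ∀ᵐ x ∂μ.1.restrict (cellIndex c ⁻¹' {cellIndex c x₀}),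
      cellIndex c x = cellIndex c x₀ :=
    ae_restrict_mem (measurable_cellIndex c (measurableSet_singleton _))
  refine hasCondDistrib_of_ae_eq_const hX hY (a := cellStar c (μ, x₀))
    (hfiber.mono fun x hx => cellStar_congr hx) ?_
  have hcell : (cellIndex c ⁻¹' {cellIndex c x₀} : Set (E d)) =ᵐ[μ.1]
      cellHomothety c x₀ ⁻¹' B1 d := by
    rw [← cellHomothety_preimage_halfCube]
    refine (LE.le.eventuallyLE (preimage_mono halfCube_subset_B1)).antisymm ?_
    rw [ae_le_set]
    exact hboundary
  rw [Measure.map_congr (hfiber.mono fun x hx => by rw [cellHomothety_congr c hx]),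
    Measure.restrict_apply_univ, Measure.restrict_congr_set hcell, measure_congr hcell]
  exact (measure_preimage_smul_ballKernel_star_push _ μ).symm

lemma IsRestrictedCP.hasCondDistrib_cellStar {b : ℕ} [NeZero b] {Q₀ : Measure (Radon d × E d)}
    (h : IsRestrictedCP b Q₀) (n : ℕ) :
    HasCondDistrib (fun p => cellHomothety (b ^ n) p.2 p.2) (cellStar (b ^ n)) (ballKernel d)
      Q₀ := by
  have := h.prob
  have hprob : IsProbabilityMeasure (Q₀.fst ⊗ₘ radonKernel d) := h.eq_compProd ▸ this
  have hboundary : ∀ᵐ μ ∂Q₀.fst, ∀ᵐ x ∂μ.1,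
      μ.1 (cellHomothety (b ^ n) x ⁻¹' (B1 d \ halfCube d)) = 0 :=
    Measure.ae_ae_of_ae_compProd (κ := radonKernel d) (h.eq_compProd ▸ h.ae_boundary n)
  have hfinite : ∀ᵐ μ ∂Q₀.fst, μ.1 univ < ∞ := by
    refine (ae_map_iff measurable_fst.aemeasurable
      (measurable_apply MeasurableSet.univ measurableSet_Iio)).mpr (h.mem.mono fun p hp => ?_)
    change p.1.1 univ < ∞
    rw [← measure_add_measure_compl measurableSet_B1, hp.1.1, hp.1.2, add_zero]
    exact ENNReal.one_lt_top
  rw [h.eq_compProd]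
  refine hasCondDistrib_compProd (measurable_cellStar (b ^ n))
    ((measurable_cellHomothety_self (b ^ n)).comp measurable_snd) ?_
  filter_upwards [hboundary, hfinite] with μ hμ huniv
  have : IsFiniteMeasure μ.1 := ⟨huniv⟩
  exact hasCondDistrib_cellStar_of_ae_boundary (b ^ n) hμ

/-! ### Setwise limits of random Radon measures -/

/-- The family of the values of a Radon measure on all Borel sets. It embeds `𝓜` in a product of
copies of `[0,∞]`, and setwise convergence is convergence in that product. -/
def evals (d : ℕ) (μ : Radon d) : {A : Set (E d) // MeasurableSet A} → ℝ≥0∞ := fun A => μ.1 A.1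

lemma measurable_evals : Measurable (evals d) :=
  measurable_pi_lambda _ fun A => measurable_apply A.2

lemma exists_evals_preimage_eq {S : Set (Radon d)} (hS : MeasurableSet S) :
    ∃ S', MeasurableSet S' ∧ evals d ⁻¹' S' = S := by
  have h : @Measurable _ _ (MeasurableSpace.comap (evals d) MeasurableSpace.pi) _
      (id : Radon d → Radon d) :=
    (@measurable_radon_iff d (Radon d) (MeasurableSpace.comap (evals d) MeasurableSpace.pi)
      id).mpr fun A hA => (measurable_pi_apply
        (⟨A, hA⟩ : {A : Set (E d) // MeasurableSet A})).comp (comap_measurable (evals d))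
  exact h hS

lemma ext_of_map_evals {m₁ m₂ : Measure (Radon d)}
    (h : m₁.map (evals d) = m₂.map (evals d)) : m₁ = m₂ := by
  ext S hS
  obtain ⟨S', hS', rfl⟩ := exists_evals_preimage_eq hS
  rw [← Measure.map_apply measurable_evals hS', h, Measure.map_apply measurable_evals hS']

variable {Ω : Type*} [MeasurableSpace Ω] {νn : ℕ → Ω → Radon d} {ν : Ω → Radon d}

-- There are uncountably many Borel sets, and the product of as many copies of `[0,∞]` is not
-- metrizable: limits of laws are compared on finite subfamilies.
lemma map_eq_of_ae_tendsto_apply {L₁ L₂ : Measure Ω} [IsFiniteMeasure L₁] [IsFiniteMeasure L₂]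
    (hνn : ∀ n, Measurable (νn n)) (hν : Measurable ν)
    (h₁ : ∀ᵐ ω ∂L₁, ∀ A : Set (E d), MeasurableSet A →
      Tendsto (fun n => (νn n ω).1 A) atTop (𝓝 ((ν ω).1 A)))
    (h₂ : ∀ᵐ ω ∂L₂, ∀ A : Set (E d), MeasurableSet A →
      Tendsto (fun n => (νn n ω).1 A) atTop (𝓝 ((ν ω).1 A)))
    (h : ∀ n, L₁.map (νn n) = L₂.map (νn n)) : L₁.map ν = L₂.map ν := by
  refine ext_of_map_evals ?_
  rw [Measure.map_map measurable_evals hν, Measure.map_map measurable_evals hν]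
  have hmarginal (J : Finset {A : Set (E d) // MeasurableSet A}) :
      (L₁.map (evals d ∘ ν)).map J.restrict = (L₂.map (evals d ∘ ν)).map J.restrict := by
    have hrestrict : Measurable (J.restrict (π := fun _ => ℝ≥0∞)) := J.measurable_restrict
    have hJ : Measurable (J.restrict (π := fun _ => ℝ≥0∞) ∘ evals d) :=
      hrestrict.comp measurable_evals
    have hlim {μn : ℕ → Radon d} {μ : Radon d} (hμ : ∀ A : Set (E d), MeasurableSet A →
        Tendsto (fun n => (μn n).1 A) atTop (𝓝 (μ.1 A))) :
        Tendsto (fun n => J.restrict (evals d (μn n))) atTop (𝓝 (J.restrict (evals d μ))) :=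
      tendsto_pi_nhds.mpr fun A => hμ A.1.1 A.1.2
    rw [Measure.map_map hrestrict (measurable_evals.comp hν),
      Measure.map_map hrestrict (measurable_evals.comp hν)]
    refine map_eq_of_ae_tendsto (fun n => hJ.comp (hνn n)) (hJ.comp hν)
      (h₁.mono fun ω => hlim) (h₂.mono fun ω => hlim) fun n => ?_
    rw [← Measure.map_map hJ (hνn n), h n, Measure.map_map hJ (hνn n)]
  have (J : Finset {A : Set (E d) // MeasurableSet A}) :
      IsFiniteMeasure ((L₁.map (evals d ∘ ν)).map J.restrict) := inferInstance
  exact IsProjectiveLimit.unique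
    (P := fun J => (L₁.map (evals d ∘ ν)).map J.restrict) (fun _ => rfl)
    fun J => (hmarginal J).symm

lemma hasCondDistrib_of_ae_tendsto_apply {L : Measure Ω} [IsFiniteMeasure L] {β : Type*}
    [MeasurableSpace β] {κ : Kernel (Radon d) β} [IsSFiniteKernel κ] {Y : Ω → β}
    (hνn : ∀ n, Measurable (νn n)) (hν : Measurable ν) (hY : Measurable Y)
    (htendsto : ∀ᵐ ω ∂L, ∀ A : Set (E d), MeasurableSet A →
      Tendsto (fun n => (νn n ω).1 A) atTop (𝓝 ((ν ω).1 A)))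
    (hκ : ∀ᵐ ω ∂L, ∀ n, κ (νn n ω) = κ (ν ω)) (h : ∀ n, HasCondDistrib Y (νn n) κ L) :
    HasCondDistrib Y ν κ L := by
  refine hasCondDistrib_of_measure_inter hν hY fun A B hA hB => ?_
  have hlaw_apply (n : ℕ) (A' : Set (Radon d)) (hA' : MeasurableSet A') :
      L (νn n ⁻¹' A' ∩ Y ⁻¹' B) = ∫⁻ ω in νn n ⁻¹' A', κ (ν ω) B ∂L := by
    rw [measure_inter_of_hasCondDistrib (h n) (hνn n) hY hA' hB]
    exact lintegral_congr_ae (ae_restrict_of_ae (hκ.mono fun ω hω => congrArg (· B) (hω n)))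
  have hfinite : IsFiniteMeasure (L.withDensity fun ω => κ (ν ω) B) := by
    refine isFiniteMeasure_withDensity (ne_of_eq_of_ne ?_ (measure_ne_top L (Y ⁻¹' B)))
    simpa using (hlaw_apply 0 univ MeasurableSet.univ).symm
  have hlaw : (L.restrict (Y ⁻¹' B)).map ν = (L.withDensity fun ω => κ (ν ω) B).map ν := by
    refine map_eq_of_ae_tendsto_apply hνn hν (ae_restrict_of_ae htendsto)
      ((withDensity_absolutelyContinuous L _).ae_le htendsto) fun n => ?_
    ext A' hA'
    rw [Measure.map_apply (hνn n) hA', Measure.map_apply (hνn n) hA',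
      Measure.restrict_apply (hνn n hA'), withDensity_apply _ (hνn n hA'), hlaw_apply n A' hA']
  rw [← Measure.restrict_apply (hν hA), ← withDensity_apply _ (hν hA),
    ← Measure.map_apply hν hA, hlaw, Measure.map_apply hν hA]

lemma tendsto_star_push {νn : ℕ → Radon d} {ν : Radon d}
    (h : ∀ A : Set (E d), MeasurableSet A → Tendsto (fun n => (νn n).1 A) atTop (𝓝 (ν.1 A)))
    (f : E d ≃ₜ E d) (hf : ν.1 (f ⁻¹' B1 d) ≠ 0) {A : Set (E d)} (hA : MeasurableSet A) :
    Tendsto (fun n => (star (push f (νn n))).1 A) atTop (𝓝 ((star (push f ν)).1 A)) := by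
  simp only [star_apply, push_apply]
  have hfin := (measure_preimage_B1_lt_top f ν).ne
  have hmass : (ν.1 (f ⁻¹' B1 d)).toNNReal ≠ 0 := ENNReal.toNNReal_ne_zero.mpr ⟨hf, hfin⟩
  have hinv := ((ENNReal.tendsto_toNNReal hfin).comp
    (h _ (f.measurable measurableSet_B1))).inv₀ hmass
  refine ENNReal.Tendsto.mul (ENNReal.tendsto_coe.mpr hinv) (Or.inl ?_) (h _ (f.measurable hA))
    (Or.inr ENNReal.coe_ne_top)
  exact_mod_cast inv_ne_zero hmass

/-! ### The two-sided process -/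

section Shift

variable {X : Type*}

/-- The shift by `k` on two-sided sequences. -/
def shift (k : ℤ) (ω : ℤ → X) : ℤ → X := fun n => ω (n + k)

lemma shift_comp_shift (i j : ℤ) : (shift i : (ℤ → X) → ℤ → X) ∘ shift j = shift (i + j) := by
  funext ω n
  simp only [shift, Function.comp_apply, add_assoc]

lemma shift_zero : (shift 0 : (ℤ → X) → ℤ → X) = id := by
  funext ω n
  simp only [shift, add_zero, id]

variable [MeasurableSpace X]

lemma measurable_shift (k : ℤ) : Measurable (shift k : (ℤ → X) → ℤ → X) :=
  measurable_pi_lambda _ fun n => measurable_pi_apply (n + k)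

lemma measurePreserving_shift {L : Measure (ℤ → X)} (h : MeasurePreserving (shift 1) L L)
    (k : ℤ) : MeasurePreserving (shift k) L L := by
  have hneg : MeasurePreserving (shift (-1)) L L :=
    measurePreserving_of_ae_leftInverse h (measurable_shift _) <| Eventually.of_forall fun ω => by
      rw [← Function.comp_apply (f := shift (-1)), shift_comp_shift, neg_add_cancel, shift_zero, id]
  induction k with
  | zero =>
    rw [shift_zero]
    exact MeasurePreserving.id L
  | succ n ih =>
    rw [← shift_comp_shift]
    exact ih.comp h
  | pred n ih =>
    rw [sub_eq_add_neg, ← shift_comp_shift]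
    exact ih.comp hneg

end Shift

/-- The two-sided stationary process `(μ_n, x_n)_{n ∈ ℤ}` (of law `L`) of the restricted
CP-distribution `Q₀`, with the setwise limit `ν` of the measures `backward b ω n`: the data of
`IsExtendedVersion`, bundled. -/
structure IsTwoSided (b : ℕ) [NeZero b] (Q₀ : Measure (Radon d × E d))
    (L : Measure (ℤ → Radon d × E d)) (ν : (ℤ → Radon d × E d) → Radon d) : Prop where
  restricted : IsRestrictedCP b Q₀
  stationary : MeasurePreserving (shift 1) L L
  marginal : MeasurePreserving (fun ω => ω 0) L Q₀
  step : ∀ᵐ ω ∂L, ∀ n : ℤ, ω (n + 1) = magBox b (ω n)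
  measurable : Measurable ν
  tendsto : ∀ᵐ ω ∂L, ∀ A : Set (E d), MeasurableSet A →
    Tendsto (fun n : ℕ => (backward b ω n).1 A) atTop (𝓝 ((ν ω).1 A))

lemma measurable_backward (b : ℕ) [NeZero b] (n : ℕ) :
    Measurable fun ω : ℤ → Radon d × E d => backward b ω n :=
  (measurable_cellStar (b ^ n)).comp (measurable_pi_apply (-(n : ℤ)))

namespace IsTwoSided

variable {b : ℕ} [NeZero b] {Q₀ : Measure (Radon d × E d)}
  {L : Measure (ℤ → Radon d × E d)} {ν : (ℤ → Radon d × E d) → Radon d}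

lemma shift_preserving (h : IsTwoSided b Q₀ L ν) (k : ℤ) : MeasurePreserving (shift k) L L :=
  measurePreserving_shift h.stationary k

lemma eval_preserving (h : IsTwoSided b Q₀ L ν) (k : ℤ) :
    MeasurePreserving (fun ω : ℤ → Radon d × E d => ω k) L Q₀ := by
  have hcomp := h.marginal.comp (h.shift_preserving k)
  simpa only [Function.comp_def, shift, zero_add] using hcomp

lemma isProbabilityMeasure (h : IsTwoSided b Q₀ L ν) : IsProbabilityMeasure L := by
  rw [← Measure.isProbabilityMeasure_map_iff h.marginal.aemeasurable, h.marginal.map_eq]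
  exact h.restricted.prob

lemma ae_eval (h : IsTwoSided b Q₀ L ν) {p : Radon d × E d → Prop} (hp : ∀ᵐ q ∂Q₀, p q) :
    ∀ᵐ ω ∂L, ∀ k : ℤ, p (ω k) :=
  ae_all_iff.mpr fun k => (h.eval_preserving k).quasiMeasurePreserving.ae hp

lemma ae_shift (h : IsTwoSided b Q₀ L ν) {p : (ℤ → Radon d × E d) → Prop}
    (hp : ∀ᵐ ω ∂L, p ω) : ∀ᵐ ω ∂L, ∀ k : ℤ, p (shift k ω) :=
  ae_all_iff.mpr fun k => (h.shift_preserving k).quasiMeasurePreserving.ae hp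

lemma ae_eq_magBox (h : IsTwoSided b Q₀ L ν) :
    ∀ᵐ ω ∂L, ∀ (k : ℤ) (n : ℕ), ω k = magBox (b ^ n) (ω (k - n)) := by
  filter_upwards [h.step, h.ae_eval h.restricted.ae_iterate] with ω hstep hiter k n
  have hadvance (j : ℤ) (m : ℕ) : (magBox b)^[m] (ω j) = ω (j + m) := by
    induction m with
    | zero => simp
    | succ m ih =>
      rw [Function.iterate_succ_apply', ih, ← hstep]
      push_cast
      rw [add_assoc]
  rw [← hiter, hadvance, sub_add_cancel]

lemma ballKernel_backward (h : IsTwoSided b Q₀ L ν) :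
    ∀ᵐ ω ∂L, ∀ n : ℕ, ballKernel d (backward b ω n) = (ω 0).1.1 := by
  filter_upwards [h.ae_eq_magBox] with ω hω n
  rw [hω 0 n, zero_sub]
  rfl

lemma ballKernel_limit (h : IsTwoSided b Q₀ L ν) :
    ∀ᵐ ω ∂L, ballKernel d (ν ω) = (ω 0).1.1 := by
  filter_upwards [h.ballKernel_backward, h.tendsto] with ω hbackward hlim
  refine Measure.ext fun A hA => ?_
  rw [ballKernel_apply, Measure.restrict_apply hA]
  refine tendsto_nhds_unique (hlim _ (hA.inter measurableSet_B1)) ?_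
  simp only [← Measure.restrict_apply hA, ← ballKernel_apply, hbackward]
  exact tendsto_const_nhds

lemma ae_fst_zero_le (h : IsTwoSided b Q₀ L ν) : ∀ᵐ ω ∂L, (ω 0).1.1 ≤ (ν ω).1 := by
  filter_upwards [h.ballKernel_limit] with ω hω
  rw [← hω]
  exact Measure.restrict_le_self

lemma ae_mem_support (h : IsTwoSided b Q₀ L ν) : ∀ᵐ ω ∂L, (ω 0).2 ∈ (ν ω).1.support := by
  filter_upwards [h.ae_fst_zero_le, h.ae_eval h.restricted.ae_mem_support] with ω hle hmem
  exact Measure.support_mono hle (hmem 0)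

lemma ae_preimage_B1_ne_zero (h : IsTwoSided b Q₀ L ν) :
    ∀ᵐ ω ∂L, ∀ n : ℕ, (ν ω).1 (cellHomothety (b ^ n) (ω 0).2 ⁻¹' B1 d) ≠ 0 := by
  filter_upwards [h.ae_fst_zero_le, h.ae_eval h.restricted.ae_preimage_B1_ne_zero]
    with ω hle hne n hnull
  exact hne 0 n (hle.absolutelyContinuous hnull)

lemma ae_backward_add (h : IsTwoSided b Q₀ L ν) :
    ∀ᵐ ω ∂L, ∀ m k : ℕ, backward b ω (k + m)
      = cellStar (b ^ m) (backward b (shift (-m) ω) k, (ω (-m)).2) := by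
  filter_upwards [h.ae_eq_magBox, h.ae_eval h.restricted.ae_preimage_B1_ne_zero]
    with ω hmag hne m k
  have hshift : shift (-m) ω (-k) = ω (-m - k) := by
    rw [shift, neg_add_eq_sub, sub_eq_add_neg, add_comm, ← sub_eq_add_neg]
  have hindex : -((k + m : ℕ) : ℤ) = -m - k := by
    push_cast
    ring
  have hsnd : (ω (-m)).2 = cellHomothety (b ^ k) (ω (-m - k)).2 (ω (-m - k)).2 :=
    congrArg Prod.snd (hmag (-m) k)
  simp only [backward, cellStar, hshift, hindex]
  rw [star_push_star, push_push, hsnd, cellHomothety_trans_cellHomothety (pow_add b k m)]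
  rw [push_apply]
  exact fun hnull => absurd hnull (hne _ k)

lemma ae_eq_cellStar (h : IsTwoSided b Q₀ L ν) :
    ∀ᵐ ω ∂L, ∀ m : ℕ, ν ω = cellStar (b ^ m) (ν (shift (-m) ω), (ω (-m)).2) := by
  filter_upwards [h.ae_backward_add, h.tendsto, h.ae_shift h.tendsto,
    h.ae_shift h.ae_preimage_B1_ne_zero] with ω hadd hlim hlim_shift hne m
  refine Subtype.ext (Measure.ext fun A hA => ?_)
  have hne' := hne (-m) m
  simp only [shift, zero_add] at hne'
  refine tendsto_nhds_unique ((tendsto_add_atTop_iff_nat m).mpr (hlim A hA)) ?_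
  simp only [hadd m]
  exact tendsto_star_push (hlim_shift (-m)) (cellHomothety (b ^ m) (ω (-m)).2) hne' hA

lemma ae_concentrated (h : IsTwoSided b Q₀ L ν) :
    ∀ᵐ ω ∂L, (ν ω).1 (⋃ m : ℕ, cellHomothety (b ^ m) (ω (-m)).2 '' B1 d)ᶜ = 0 := by
  filter_upwards [h.tendsto, h.ae_eval h.restricted.mem] with ω hlim hmem
  have hmeas : MeasurableSet (⋃ m : ℕ, cellHomothety (b ^ m) (ω (-m)).2 '' B1 d) :=
    MeasurableSet.iUnion fun m : ℕ =>
      ((cellHomothety (b ^ m) (ω (-m)).2).isClosedMap _ Metric.isClosed_closedBall).measurableSet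
  refine tendsto_nhds_unique (hlim _ hmeas.compl) ?_
  have hnull (n : ℕ) : (backward b ω n).1
      (⋃ m : ℕ, cellHomothety (b ^ m) (ω (-m)).2 '' B1 d)ᶜ = 0 := by
    rw [backward, star_apply]
    refine mul_eq_zero_of_right _ ?_
    rw [push_apply]
    refine measure_mono_null ?_ (hmem (-n)).1.2
    intro y hy hyB
    exact hy (mem_iUnion.mpr ⟨n, mem_image_of_mem _ hyB⟩)
  simp only [hnull]
  exact tendsto_const_nhds

lemma measurable_pair (h : IsTwoSided b Q₀ L ν) :
    Measurable fun ω : ℤ → Radon d × E d => (ν ω, (ω 0).2) :=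
  h.measurable.prodMk (measurable_snd.comp (measurable_pi_apply 0))

lemma ae_magStar (h : IsTwoSided b Q₀ L ν) :
    ∀ᵐ ω ∂L, (ν (shift 1 ω), (shift 1 ω 0).2) = magStar b (ν ω, (ω 0).2) := by
  filter_upwards [h.ae_shift h.ae_eq_cellStar, h.step] with ω hcell hstep
  have hback : shift (-(1 : ℕ)) (shift 1 ω) = ω := by
    rw [← Function.comp_apply (f := shift _), shift_comp_shift]
    exact congrFun shift_zero ω
  have hν := hcell 1 1
  rw [hback] at hν
  have hsnd : (shift 1 ω 0).2 = (magBox b (ω 0)).2 := congrArg Prod.snd (hstep 0)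
  refine Prod.ext ?_ hsnd
  simpa [shift, cellStar, magStar] using! hν

lemma magStar_preserving (h : IsTwoSided b Q₀ L ν) :
    MeasurePreserving (magStar b) (L.map fun ω => (ν ω, (ω 0).2))
      (L.map fun ω => (ν ω, (ω 0).2)) :=
  measurePreserving_of_ae_semiconj (h.measurable_pair.measurePreserving L) h.stationary
    (measurable_magStar b) h.ae_magStar

lemma hasCondDistrib (h : IsTwoSided b Q₀ L ν) :
    HasCondDistrib (fun ω => (ω 0).2) ν (ballKernel d) L := by
  have := h.isProbabilityMeasure
  refine hasCondDistrib_of_ae_tendsto_apply (measurable_backward b) h.measurable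
    (measurable_snd.comp (measurable_pi_apply 0)) h.tendsto ?_ fun n => ?_
  · filter_upwards [h.ballKernel_backward, h.ballKernel_limit] with ω hbackward hlim n
    rw [hbackward, hlim]
  · have hstage := hasCondDistrib_comp_of_measurePreserving
      (h.restricted.hasCondDistrib_cellStar n) (h.eval_preserving (-n)) (measurable_cellStar _)
      ((measurable_cellHomothety_self (b ^ n)).comp measurable_snd)
    refine HasLaw.congr hstage ?_
    filter_upwards [h.ae_eq_magBox] with ω hω
    rw [hω 0 n, zero_sub]
    rfl

end IsTwoSided

/-! ### Suspensions -/

section Suspension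

lemma isProbabilityMeasure_unifIco {c : ℝ} (hc : 0 < c) : IsProbabilityMeasure (unifIco c) := by
  refine ⟨?_⟩
  rw [unifIco, Measure.smul_apply, Measure.restrict_apply_univ, Real.volume_Ico, sub_zero,
    smul_eq_mul, ENNReal.inv_mul_cancel (by simpa using hc) ENNReal.ofReal_ne_top]

instance isFiniteMeasure_unifIco (c : ℝ) : IsFiniteMeasure (unifIco c) := by
  refine ⟨?_⟩
  rw [unifIco, Measure.smul_apply, Measure.restrict_apply_univ, Real.volume_Ico, sub_zero]
  exact ENNReal.inv_mul_le_one _ |>.trans_lt ENNReal.one_lt_top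

lemma ae_mem_Ico_unifIco (c : ℝ) : ∀ᵐ r ∂unifIco c, r ∈ Ico 0 c :=
  Measure.ae_smul_measure (ae_restrict_mem measurableSet_Ico) _

lemma mul_fract_div_eq_self {c r : ℝ} (hr : r ∈ Ico 0 c) : c * Int.fract (r / c) = r := by
  have hc : 0 < c := hr.1.trans_lt hr.2
  rw [Int.fract_eq_self.mpr ⟨div_nonneg hr.1 hc.le, (div_lt_one hc).mpr hr.2⟩,
    mul_div_cancel₀ _ hc.ne']

lemma measurePreserving_mul_fract {c : ℝ} (hc : 0 < c) (t : ℝ) :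
    MeasurePreserving (fun r => c * Int.fract ((r + t) / c)) (unifIco c) (unifIco c) := by
  have := Fact.mk hc
  let lift (z : AddCircle c) : ℝ := AddCircle.equivIco c 0 z
  have hlift_coe (r : ℝ) : lift r = c * Int.fract (r / c) := by
    rw [mul_comm]
    exact AddCircle.coe_equivIco_mk_apply c r
  have hlift : Measurable lift :=
    measurable_subtype_coe.comp (AddCircle.measurableEquivIco c 0).measurable
  have hmk : MeasurePreserving ((↑) : ℝ → AddCircle c) (volume.restrict (Ico 0 c)) volume := by
    have := AddCircle.measurePreserving_mk c 0
    rwa [zero_add, ← restrict_Ico_eq_restrict_Ioc] at this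
  have hlift_preserving : MeasurePreserving lift volume (volume.restrict (Ico 0 c)) := by
    refine measurePreserving_of_ae_leftInverse hmk hlift ?_
    filter_upwards [ae_restrict_mem measurableSet_Ico] with r hr
    rw [hlift_coe, mul_fract_div_eq_self hr]
  have hrotate := hlift_preserving.comp
    ((measurePreserving_add_right volume (t : AddCircle c)).comp hmk)
  have hfract : lift ∘ (· + (t : AddCircle c)) ∘ ((↑) : ℝ → AddCircle c)
      = fun r => c * Int.fract ((r + t) / c) :=
    funext fun r => hlift_coe (r + t)
  rw [hfract] at hrotate
  exact hrotate.smul_measure _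

variable {Ω : Type*} {f : Ω → Ω} {c : ℝ}

lemma suspFlow_zero {p : Ω × ℝ} (hp : p.2 ∈ Ico 0 c) : suspFlow c f 0 p = p := by
  have hlt : p.2 / c < 1 := (div_lt_one (hp.1.trans_lt hp.2)).mpr hp.2
  rw [suspFlow, add_zero, Nat.floor_eq_zero.mpr hlt, mul_fract_div_eq_self hp]
  rfl

lemma suspFlow_add (hc : 0 < c) {p : Ω × ℝ} (hp : 0 ≤ p.2) {t u : ℝ} (ht : 0 ≤ t) (hu : 0 ≤ u) :
    suspFlow c f (t + u) p = suspFlow c f t (suspFlow c f u p) := by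
  have hu' : 0 ≤ (p.2 + u) / c := by positivity
  have hsplit : (p.2 + u) / c = ⌊(p.2 + u) / c⌋₊ + Int.fract ((p.2 + u) / c) := by
    rw [natCast_floor_eq_intCast_floor hu']
    exact (Int.floor_add_fract _).symm
  have htime : (p.2 + (t + u)) / c
      = ⌊(p.2 + u) / c⌋₊ + (c * Int.fract ((p.2 + u) / c) + t) / c := by
    rw [add_div (c * _), mul_div_cancel_left₀ _ hc.ne']
    linear_combination hsplit
  have hrest : 0 ≤ (c * Int.fract ((p.2 + u) / c) + t) / c := by
    have := Int.fract_nonneg ((p.2 + u) / c)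
    positivity
  simp only [suspFlow]
  rw [htime, Int.fract_natCast_add, add_comm (_ : ℝ), Nat.floor_add_natCast hrest,
    Function.iterate_add_apply]

variable [MeasurableSpace Ω] {Q : Measure Ω}

lemma measurePreserving_suspFlow [SFinite Q] (hf : MeasurePreserving f Q Q) (hc : 0 < c) (t : ℝ) :
    MeasurePreserving (suspFlow c f t) (suspMeasure c Q) (suspMeasure c Q) := by
  have hfiber : Measurable fun q : ℝ × Ω => f^[⌊(q.1 + t) / c⌋₊] q.2 := by
    have hiter : Measurable fun q : ℕ × Ω => f^[q.1] q.2 :=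
      measurable_from_prod_countable_right fun n => hf.measurable.iterate n
    have hfloor : Measurable fun r : ℝ => ⌊(r + t) / c⌋₊ :=
      Nat.measurable_floor.comp ((measurable_id.add_const t).div_const c)
    exact hiter.comp (hfloor.prodMap measurable_id)
  have hskew : MeasurePreserving
      (fun q : ℝ × Ω => (c * Int.fract ((q.1 + t) / c), f^[⌊(q.1 + t) / c⌋₊] q.2))
      ((unifIco c).prod Q) ((unifIco c).prod Q) :=
    (measurePreserving_mul_fract hc t).skew_product hfiber <|
      Eventually.of_forall fun r => (hf.iterate ⌊(r + t) / c⌋₊).map_eq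
  exact Measure.measurePreserving_swap.comp (hskew.comp Measure.measurePreserving_swap)

lemma isMPSemiflow_suspFlow [IsProbabilityMeasure Q] (hf : MeasurePreserving f Q Q)
    (hc : 0 < c) : IsMPSemiflow (suspMeasure c Q) (suspFlow c f) := by
  have := isProbabilityMeasure_unifIco hc
  have hmem : ∀ᵐ p ∂suspMeasure c Q, p.2 ∈ Ico 0 c :=
    Measure.quasiMeasurePreserving_snd.ae (ae_mem_Ico_unifIco c)
  exact
    { prob := by
        unfold suspMeasure
        infer_instance
      preserving := fun t _ => measurePreserving_suspFlow hf hc t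
      zero := hmem.mono fun p hp => suspFlow_zero hp
      add := hmem.mono fun p hp t u ht hu => suspFlow_add hc hp.1 ht hu }

end Suspension

/-! ### Sceneries -/

/-- The homothety `S_r T_x : y ↦ e^r (y - x)`. -/
noncomputable def zoom (x : E d) (r : ℝ) : E d ≃ₜ E d := (trans x).trans (scale r)

/-- The scenery `S_r^* T_x^* μ` of `μ` at the point `x` and the scale `e^{-r}`. -/
noncomputable def scenery (x : E d) (r : ℝ) (μ : Radon d) : Radon d := scaleStar r (transStar x μ)

lemma zoom_apply (x : E d) (r : ℝ) (y : E d) : zoom x r y = Real.exp r • (y - x) := rfl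

lemma zoom_preimage_B1 (x : E d) (r : ℝ) :
    zoom x r ⁻¹' B1 d = Metric.closedBall x (Real.exp (-r)) := by
  change trans x ⁻¹' (scale r ⁻¹' B1 d) = _
  rw [scale_preimage_B1]
  ext y
  rw [mem_preimage, mem_closedBall_zero_iff, Metric.mem_closedBall, dist_eq_norm]
  rfl

lemma zoom_trans_trans (x z : E d) (r : ℝ) :
    (zoom x r).trans (trans (zoom x r z)) = zoom z r := by
  ext1 y
  change zoom x r y - zoom x r z = zoom z r y
  simp only [zoom_apply, ← smul_sub, sub_sub_sub_cancel_right]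

lemma measurable_scenery {α : Type*} [MeasurableSpace α] {x : α → E d} {r : α → ℝ}
    {m : α → Radon d} (hx : Measurable x) (hr : Measurable r) (hm : Measurable m) :
    Measurable fun a => scenery (x a) (r a) (m a) :=
  measurable_scaleStar hr (measurable_transStar hx hm)

lemma scaleStar_star {r : ℝ} (hr : 0 ≤ r) (μ : Radon d) : scaleStar r (star μ) = scaleStar r μ := by
  rw [← scaleStar_zero, scaleStar_scaleStar_of_nonneg hr, add_zero]

lemma scenery_eq {r : ℝ} (hr : 0 ≤ r) (x : E d) (μ : Radon d) :
    scenery x r μ = star (push (zoom x r) μ) := by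
  rw [scenery, transStar, scaleStar_star hr, scaleStar, push_push, zoom]

lemma scaleStar_scenery {t : ℝ} (ht : 0 ≤ t) (x : E d) (r : ℝ) (μ : Radon d) :
    scaleStar t (scenery x r μ) = scenery x (t + r) μ :=
  scaleStar_scaleStar_of_nonneg ht r _

section MemSupport

variable {μ : Radon d} {x : E d} {r : ℝ}

lemma measure_ne_zero_of_mem_support (hx : x ∈ μ.1.support) {V : Set (E d)} (hV : V ∈ 𝓝 x) :
    μ.1 V ≠ 0 :=
  ((Measure.mem_support_iff_forall x).mp hx V hV).ne'

lemma push_zoom_B1_ne_zero (hx : x ∈ μ.1.support) (r : ℝ) :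
    (push (zoom x r) μ).1 (B1 d) ≠ 0 := by
  rw [push_apply, zoom_preimage_B1]
  exact measure_ne_zero_of_mem_support hx (Metric.closedBall_mem_nhds x (Real.exp_pos _))

lemma scenery_mem_MStar (hx : x ∈ μ.1.support) (hr : 0 ≤ r) : scenery x r μ ∈ MStar d := by
  rw [scenery_eq hr]
  exact star_mem_MStar (push_zoom_B1_ne_zero hx r)

lemma ae_scenery_iff (hx : x ∈ μ.1.support) (hr : 0 ≤ r) {p : E d → Prop} :
    (∀ᵐ y ∂(scenery x r μ).1, p y) ↔ ∀ᵐ z ∂μ.1, p (zoom x r z) := by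
  rw [ae_iff, scenery_eq hr, star_apply_eq_zero_iff (push_zoom_B1_ne_zero hx r), push_apply]
  rfl

lemma zero_mem_support_scenery (hx : x ∈ μ.1.support) (hr : 0 ≤ r) :
    0 ∈ (scenery x r μ).1.support := by
  refine (Measure.mem_support_iff_forall _).mpr fun V hV => pos_iff_ne_zero.mpr ?_
  rw [scenery_eq hr, Ne, star_apply_eq_zero_iff (push_zoom_B1_ne_zero hx r), push_apply]
  have hzero : zoom x r x = 0 := by rw [zoom_apply, sub_self, smul_zero]
  exact measure_ne_zero_of_mem_support hx
    ((zoom x r).continuous.continuousAt.preimage_mem_nhds (hzero ▸ hV))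

lemma transStar_scenery (hx : x ∈ μ.1.support) (hr : 0 ≤ r) (z : E d) :
    transStar (zoom x r z) (scenery x r μ) = scenery z r μ := by
  rw [scenery_eq hr, scenery_eq hr, transStar,
    star_push_star _ fun hnull => absurd hnull (push_zoom_B1_ne_zero hx r), push_push,
    zoom_trans_trans]

end MemSupport

lemma transStar_cellStar (c : ℕ) [NeZero c] (x y : E d) {μ : Radon d}
    (h : μ.1 (cellHomothety c x ⁻¹' B1 d) ≠ 0) :
    transStar (cellHomothety c x y) (cellStar c (μ, x)) = scenery y (Real.log c) μ := by
  have hc : (0 : ℝ) < c := Nat.cast_pos.mpr (Nat.pos_of_neZero c)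
  have hzoom : (cellHomothety c x).trans (trans (cellHomothety c x y)) = zoom y (Real.log c) := by
    ext1 z
    change cellHomothety c x z - cellHomothety c x y = zoom y (Real.log c) z
    simp only [cellHomothety_apply, zoom_apply, Real.exp_log hc, ← smul_sub,
      sub_sub_sub_cancel_right]
  rw [transStar, cellStar, star_push_star, push_push, hzoom, scenery_eq (Real.log_natCast_nonneg c)]
  rw [push_apply]
  exact fun hnull => absurd hnull h

lemma scenery_cellStar (c : ℕ) [NeZero c] (x y : E d) {μ : Radon d}
    (h : μ.1 (cellHomothety c x ⁻¹' B1 d) ≠ 0) {r : ℝ} (hr : 0 ≤ r) :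
    scenery (cellHomothety c x y) r (cellStar c (μ, x)) = scenery y (r + Real.log c) μ := by
  rw [scenery, transStar_cellStar c x y h, scaleStar_scenery hr]

lemma scenery_iterate_magStar (b : ℕ) [NeZero b] {p : Radon d × E d}
    (h : ∀ n : ℕ, ((magStar b)^[n] p).1.1
      (cellHomothety b ((magStar b)^[n] p).2 ⁻¹' B1 d) ≠ 0) (n : ℕ) {r : ℝ} (hr : 0 ≤ r) :
    scenery ((magStar b)^[n] p).2 r ((magStar b)^[n] p).1
      = scenery p.2 (r + n * Real.log b) p.1 := by
  induction n generalizing r with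
  | zero => simp
  | succ n ih =>
    have hlog := Real.log_natCast_nonneg b
    rw [Function.iterate_succ_apply']
    refine (scenery_cellStar b _ _ (h n) hr).trans ?_
    rw [ih (add_nonneg hr hlog)]
    push_cast
    congr 1
    ring

/-! ### Centerings of extended CP-distributions -/

/-- The properties of an extended CP-distribution `Q` that make its centering `P` a fractal
distribution, except for the absolute continuity of `∫ ⟨μ⟩_U dP(μ)` with respect to `P`:
`Q` is invariant under `M_b^*`, almost every `(μ, x)` has `x` in the support of `μ` and `μ` charges
the cell of `x`, and given `μ` the point `x` is distributed according to `μ|_{B_1}`. -/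
structure IsExtendedCP (b : ℕ) [NeZero b] (Q : Measure (Radon d × E d)) : Prop where
  prob : IsProbabilityMeasure Q
  preserving : MeasurePreserving (magStar b) Q Q
  support : ∀ᵐ p ∂Q, p.2 ∈ p.1.1.support
  cell : ∀ᵐ p ∂Q, p.1.1 (cellHomothety b p.2 ⁻¹' B1 d) ≠ 0
  adapted : HasCondDistrib Prod.snd Prod.fst (ballKernel d) Q

lemma IsTwoSided.isExtendedCP {b : ℕ} [NeZero b] {Q₀ : Measure (Radon d × E d)}
    {L : Measure (ℤ → Radon d × E d)} {ν : (ℤ → Radon d × E d) → Radon d}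
    (h : IsTwoSided b Q₀ L ν) : IsExtendedCP b (L.map fun ω => (ν ω, (ω 0).2)) where
  prob := by
    have := h.isProbabilityMeasure
    exact Measure.isProbabilityMeasure_map h.measurable_pair.aemeasurable
  preserving := h.magStar_preserving
  support := (ae_map_iff h.measurable_pair.aemeasurable measurableSet_mem_support).mpr
    h.ae_mem_support
  cell := by
    have hmeas : MeasurableSet {p : Radon d × E d | p.1.1 (cellHomothety b p.2 ⁻¹' B1 d) ≠ 0} :=
      (measurable_measure_cellHomothety_preimage b measurableSet_B1)
        (measurableSet_singleton 0).compl
    rw [ae_map_iff h.measurable_pair.aemeasurable hmeas]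
    filter_upwards [h.ae_preimage_B1_ne_zero] with ω hω
    simpa only [pow_one] using! hω 1
  adapted := by
    refine ⟨(measurable_fst.prodMk measurable_snd).aemeasurable, ?_⟩
    rw [Measure.map_map measurable_fst h.measurable_pair]
    exact Measure.map_id.trans h.hasCondDistrib.map_eq

lemma measurePreserving_scenery (b : ℕ) (Q : Measure (Radon d × E d)) [SFinite Q] :
    MeasurePreserving (fun q : (Radon d × E d) × ℝ => scenery q.1.2 q.2 q.1.1)
      (suspMeasure (Real.log b) Q) (centering b Q) := by
  have hmeas : Measurable fun q : (Radon d × E d) × ℝ => scenery q.1.2 q.2 q.1.1 :=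
    measurable_scenery measurable_fst.snd measurable_snd measurable_fst.fst
  have htrans : Measurable fun p : Radon d × E d => transStar p.2 p.1 :=
    measurable_transStar measurable_snd measurable_fst
  have hscale (t : ℝ) : Measurable (scaleStar (d := d) t) :=
    measurable_scaleStar measurable_const measurable_id
  have hslice (t : ℝ) {A : Set (Radon d)} (hA : MeasurableSet A) :
      ((discreteCentering Q).map (scaleStar t)) A
        = Q ((·, t) ⁻¹' ((fun q : (Radon d × E d) × ℝ => scenery q.1.2 q.2 q.1.1) ⁻¹' A)) := by
    rw [discreteCentering, Measure.map_map (hscale t) htrans,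
      Measure.map_apply ((hscale t).comp htrans) hA]
    rfl
  have hkernel : Measurable fun t : ℝ => (discreteCentering Q).map (scaleStar t) := by
    refine Measure.measurable_of_measurable_coe _ fun A hA => ?_
    simp only [hslice _ hA]
    exact measurable_measure_prodMk_right (hmeas hA)
  refine ⟨hmeas, Measure.ext fun A hA => ?_⟩
  rw [Measure.map_apply hmeas hA, suspMeasure, Measure.prod_apply_symm (hmeas hA), centering,
    Measure.bind_apply hA hkernel.aemeasurable]
  exact lintegral_congr fun t => (hslice t hA).symm

namespace IsExtendedCP

variable {b : ℕ} [NeZero b] {Q : Measure (Radon d × E d)}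

lemma ae_suspMeasure (h : IsExtendedCP b Q) :
    ∀ᵐ q ∂suspMeasure (Real.log b) Q, q.1.2 ∈ q.1.1.1.support ∧ q.2 ∈ Ico 0 (Real.log b) := by
  have := h.prob
  filter_upwards [Measure.quasiMeasurePreserving_fst.ae h.support,
    Measure.quasiMeasurePreserving_snd.ae (ae_mem_Ico_unifIco (Real.log b))] with q hx hr
    using ⟨hx, hr⟩

lemma ae_scenery_suspFlow (h : IsExtendedCP b Q) (hb : 2 ≤ b) :
    ∀ᵐ q ∂suspMeasure (Real.log b) Q, ∀ t : ℝ, 0 ≤ t →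
      scenery (suspFlow (Real.log b) (magStar b) t q).1.2
          (suspFlow (Real.log b) (magStar b) t q).2 (suspFlow (Real.log b) (magStar b) t q).1.1
        = scaleStar t (scenery q.1.2 q.2 q.1.1) := by
  have := h.prob
  have hc : 0 < Real.log b := Real.log_pos (by exact_mod_cast hb)
  have hcell : ∀ᵐ p ∂Q, ∀ n : ℕ, ((magStar b)^[n] p).1.1
      (cellHomothety b ((magStar b)^[n] p).2 ⁻¹' B1 d) ≠ 0 :=
    ae_all_iff.mpr fun n => (h.preserving.iterate n).quasiMeasurePreserving.ae h.cell
  filter_upwards [Measure.quasiMeasurePreserving_fst.ae hcell, h.ae_suspMeasure]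
    with q hq ⟨_, hr⟩ t ht
  have htime : 0 ≤ (q.2 + t) / Real.log b := div_nonneg (add_nonneg hr.1 ht) hc.le
  simp only [suspFlow]
  rw [scenery_iterate_magStar b hq _ (mul_nonneg hc.le (Int.fract_nonneg _)),
    scaleStar_scenery ht, natCast_floor_eq_intCast_floor htime]
  congr 1
  calc Real.log b * Int.fract ((q.2 + t) / Real.log b) + ⌊(q.2 + t) / Real.log b⌋ * Real.log b
      = Real.log b * (⌊(q.2 + t) / Real.log b⌋ + Int.fract ((q.2 + t) / Real.log b)) := by ring
    _ = t + q.2 := by rw [Int.floor_add_fract, mul_div_cancel₀ _ hc.ne', add_comm]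

lemma isProbabilityMeasure_centering (h : IsExtendedCP b Q) (hb : 2 ≤ b) :
    IsProbabilityMeasure (centering b Q) := by
  have := h.prob
  have := isProbabilityMeasure_unifIco (c := Real.log b) (Real.log_pos (by exact_mod_cast hb))
  rw [← (measurePreserving_scenery b Q).map_eq, suspMeasure]
  exact Measure.isProbabilityMeasure_map (measurePreserving_scenery b Q).aemeasurable

lemma ae_centering (h : IsExtendedCP b Q) :
    ∀ᵐ μ ∂centering b Q, μ ∈ MStar d ∧ 0 ∈ μ.1.support := by
  have := h.prob
  have hMStar : MeasurableSet (MStar d) :=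
    measurable_apply measurableSet_B1 (measurableSet_singleton 1)
  have hsupport : MeasurableSet {μ : Radon d | 0 ∈ μ.1.support} :=
    measurable_prodMk_right measurableSet_mem_support
  have hscenery := measurePreserving_scenery b Q
  rw [← hscenery.map_eq]
  refine (ae_map_iff hscenery.aemeasurable (hMStar.inter hsupport)).mpr ?_
  filter_upwards [h.ae_suspMeasure] with q ⟨hx, hr⟩
  exact ⟨scenery_mem_MStar hx hr.1, zero_mem_support_scenery hx hr.1⟩

lemma measurePreserving_scaleStar (h : IsExtendedCP b Q) (hb : 2 ≤ b) (t : ℝ) :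
    MeasurePreserving (scaleStar t) (centering b Q) (centering b Q) := by
  have := h.prob
  have hc : 0 < Real.log b := Real.log_pos (by exact_mod_cast hb)
  have hmeas (t : ℝ) : Measurable (scaleStar (d := d) t) :=
    measurable_scaleStar measurable_const measurable_id
  have hnonneg {t : ℝ} (ht : 0 ≤ t) :
      MeasurePreserving (scaleStar t) (centering b Q) (centering b Q) := by
    refine measurePreserving_of_ae_semiconj (measurePreserving_scenery b Q)
      (measurePreserving_suspFlow h.preserving hc t) (hmeas t) ?_
    filter_upwards [h.ae_scenery_suspFlow hb] with q hq using hq t ht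
  rcases le_total 0 t with ht | ht
  · exact hnonneg ht
  refine measurePreserving_of_ae_leftInverse (hnonneg (neg_nonneg.mpr ht)) (hmeas t) ?_
  filter_upwards [h.ae_centering] with μ ⟨hμ, hsupport⟩
  rw [scaleStar_scaleStar, add_neg_cancel, scaleStar_zero, star_eq_self hμ]
  exact fun hnull => absurd hnull
    (measure_ne_zero_of_mem_support hsupport (Metric.closedBall_mem_nhds 0 (Real.exp_pos _)))

lemma isMPSemiflow_centering (h : IsExtendedCP b Q) (hb : 2 ≤ b) :
    IsMPSemiflow (centering b Q) scaleStar where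
  prob := h.isProbabilityMeasure_centering hb
  preserving t _ := h.measurePreserving_scaleStar hb t
  zero := by
    filter_upwards [h.ae_centering] with μ ⟨hμ, _⟩
    rw [scaleStar_zero, star_eq_self hμ]
  add := Eventually.of_forall fun μ t u ht _ => (scaleStar_scaleStar_of_nonneg ht u μ).symm

lemma isFactor_centering (h : IsExtendedCP b Q) (hb : 2 ≤ b) :
    IsFactor (centering b Q) scaleStar (suspMeasure (Real.log b) Q)
      (suspFlow (Real.log b) (magStar b)) := by
  have := h.prob
  exact ⟨h.isMPSemiflow_centering hb,
    isMPSemiflow_suspFlow h.preserving (Real.log_pos (by exact_mod_cast hb)), _,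
    measurePreserving_scenery b Q, h.ae_scenery_suspFlow hb⟩

end IsExtendedCP

/-! ### The quasi-Palm property -/

lemma ae_of_ae_exists_mem_nhds {α : Type*} [TopologicalSpace α] [SecondCountableTopology α]
    [MeasurableSpace α] {μ : Measure α} {p : α → Prop}
    (h : ∀ᵐ x ∂μ, ∃ V ∈ 𝓝 x, ∀ᵐ z ∂μ, z ∈ V → p z) : ∀ᵐ x ∂μ, p x := by
  have hnull : μ {x | (∃ V ∈ 𝓝 x, ∀ᵐ z ∂μ, z ∈ V → p z) ∧ ¬ p x} = 0 := by
    refine measure_null_of_locally_null _ fun x ⟨⟨V, hV, hz⟩, _⟩ =>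
      ⟨_, inter_mem_nhdsWithin _ hV, measure_mono_null ?_ (ae_iff.mp hz)⟩
    exact fun z ⟨⟨_, hpz⟩, hzV⟩ hp => hpz (hp hzV)
  filter_upwards [h, measure_eq_zero_iff_ae_notMem.mp hnull] with x hx hx'
  by_contra hpx
  exact hx' ⟨hx, hpx⟩

lemma measurable_transStar_uncurry : Measurable fun q : Radon d × E d => transStar q.2 q.1 :=
  measurable_transStar measurable_snd measurable_fst

lemma diffusion_apply_eq_zero_iff {U : Set (E d)} (hU : MeasurableSet U) (μ : Radon d)
    {N : Set (Radon d)} (hN : MeasurableSet N) :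
    diffusion U μ N = 0 ↔ ∀ᵐ y ∂μ.1, y ∈ U → transStar y μ ∉ N := by
  have htrans : Measurable fun y => transStar y μ :=
    measurable_transStar measurable_id measurable_const
  rw [measure_eq_zero_iff_ae_notMem, diffusion, ae_map_iff htrans.aemeasurable hN.compl,
    ae_restrict_iff' hU]

lemma measurable_diffusion {U : Set (E d)} (hU : MeasurableSet U) : Measurable (diffusion U) := by
  refine Measure.measurable_of_measurable_coe _ fun A hA => ?_
  have htrans (μ : Radon d) : Measurable fun y => transStar y μ :=
    measurable_transStar measurable_id measurable_const
  simp only [diffusion, Measure.map_apply (htrans _) hA, Measure.restrict_apply (htrans _ hA)]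
  exact measurable_measure_section measurable_id
    ((measurable_transStar_uncurry hA).inter (measurable_snd hU))

lemma bind_diffusion_apply_eq_zero_iff (P : Measure (Radon d)) {U : Set (E d)}
    (hU : MeasurableSet U) {N : Set (Radon d)} (hN : MeasurableSet N) :
    P.bind (diffusion U) N = 0 ↔
      ∀ᵐ μ ∂P, ∀ᵐ y ∂μ.1, y ∈ U → transStar y μ ∉ N := by
  have hzero : Measurable fun μ => diffusion U μ N :=
    (Measure.measurable_coe hN).comp (measurable_diffusion hU)
  rw [Measure.bind_apply hN (measurable_diffusion hU).aemeasurable, lintegral_eq_zero_iff hzero]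
  exact eventually_congr <| Eventually.of_forall fun μ => diffusion_apply_eq_zero_iff hU μ hN

namespace IsExtendedCP

variable {b : ℕ} [NeZero b] {Q : Measure (Radon d × E d)}

lemma ae_suspMeasure_iff_ae_ae (h : IsExtendedCP b Q) (c : ℝ) {S : Set ((Radon d × ℝ) × E d)}
    (hS : MeasurableSet S) :
    (∀ᵐ q ∂suspMeasure c Q, ((q.1.1, q.2), q.1.2) ∈ S) ↔
      ∀ᵐ q ∂suspMeasure c Q, ∀ᵐ x ∂q.1.1.1.restrict (B1 d), ((q.1.1, q.2), x) ∈ S := by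
  have := h.prob
  exact ae_iff_ae_ae_of_hasCondDistrib (P := Q.prod (unifIco c))
    (hasCondDistrib_prod h.adapted measurable_fst measurable_snd)
    (measurable_fst.fst.prodMk measurable_snd) measurable_fst.snd hS

lemma centering_apply_eq_zero_iff (h : IsExtendedCP b Q) {N : Set (Radon d)}
    (hN : MeasurableSet N) :
    centering b Q N = 0 ↔ ∀ᵐ q ∂suspMeasure (Real.log b) Q,
      ∀ᵐ x ∂q.1.1.1.restrict (B1 d), scenery x q.2 q.1.1 ∉ N := by
  have := h.prob
  have hscenery := measurePreserving_scenery b Q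
  have hgood : MeasurableSet {p : (Radon d × ℝ) × E d | scenery p.2 p.1.2 p.1.1 ∉ N} :=
    measurable_scenery measurable_snd measurable_fst.snd measurable_fst.fst hN.compl
  rw [← hscenery.map_eq, measure_eq_zero_iff_ae_notMem]
  exact (ae_map_iff hscenery.aemeasurable hN.compl).trans (h.ae_suspMeasure_iff_ae_ae _ hgood)

lemma bind_diffusion_centering_apply_eq_zero_iff (h : IsExtendedCP b Q) {U : Set (E d)}
    (hU : MeasurableSet U) {N : Set (Radon d)} (hN : MeasurableSet N) :
    (centering b Q).bind (diffusion U) N = 0 ↔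
      ∀ᵐ q ∂suspMeasure (Real.log b) Q, ∀ᵐ z ∂q.1.1.1,
        zoom q.1.2 q.2 z ∈ U → scenery z q.2 q.1.1 ∉ N := by
  have := h.prob
  have hscenery := measurePreserving_scenery b Q
  have hgood : MeasurableSet {p : Radon d × E d | p.2 ∈ U → transStar p.2 p.1 ∉ N} :=
    (measurable_snd hU).himp (measurable_transStar_uncurry hN.compl)
  rw [bind_diffusion_apply_eq_zero_iff _ hU hN, ← hscenery.map_eq]
  refine (ae_map_iff hscenery.aemeasurable
    (measurableSet_ae_section measurable_id hgood)).trans (eventually_congr ?_)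
  filter_upwards [h.ae_suspMeasure] with q ⟨hx, hr⟩
  refine (ae_scenery_iff hx hr.1).trans ?_
  simp only [transStar_scenery hx hr.1]

lemma absolutelyContinuous_bind_diffusion (h : IsExtendedCP b Q) {U : Set (E d)}
    (hU : IsOpen U) (hU0 : (0 : E d) ∈ U) :
    centering b Q ≪ (centering b Q).bind (diffusion U) := by
  refine Measure.AbsolutelyContinuous.mk fun N hN hnull => ?_
  rw [h.bind_diffusion_centering_apply_eq_zero_iff hU.measurableSet hN] at hnull
  rw [h.centering_apply_eq_zero_iff hN]
  have hzoom : Measurable fun p : ((Radon d × ℝ) × E d) × E d => zoom p.1.2 p.1.1.2 p.2 :=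
    measurable_fst.fst.snd.exp.smul (measurable_snd.sub measurable_fst.snd)
  have hscenery : Measurable fun p : ((Radon d × ℝ) × E d) × E d =>
      scenery p.2 p.1.1.2 p.1.1.1 :=
    measurable_scenery measurable_snd measurable_fst.fst.snd measurable_fst.fst.fst
  have hgood : MeasurableSet {a : (Radon d × ℝ) × E d |
      ∀ᵐ z ∂a.1.1.1, zoom a.2 a.1.2 z ∈ U → scenery z a.1.2 a.1.1 ∉ N} :=
    measurableSet_ae_section measurable_fst.fst
      ((hzoom hU.measurableSet).himp (hscenery hN.compl))
  filter_upwards [(h.ae_suspMeasure_iff_ae_ae _ hgood).mp hnull] with q hq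
  refine ae_of_ae_exists_mem_nhds ?_
  filter_upwards [hq] with x hx
  refine ⟨zoom x q.2 ⁻¹' U, (zoom x q.2).continuous.continuousAt.preimage_mem_nhds ?_,
    ae_restrict_of_ae hx⟩
  rw [zoom_apply, sub_self, smul_zero]
  exact hU.mem_nhds hU0

end IsExtendedCP

lemma ae_scenery_cellStar_notMem (c : ℕ) [NeZero c] (x : E d) {μ : Radon d}
    (hμ : μ.1 (cellHomothety c x ⁻¹' B1 d) ≠ 0) {r : ℝ} (hr : 0 ≤ r) {N : Set (Radon d)}
    (hN : ∀ᵐ y ∂μ.1.restrict (B1 d), scenery y r μ ∉ scaleStar (Real.log c) ⁻¹' N) :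
    ∀ᵐ z ∂(cellStar c (μ, x)).1, z ∈ cellHomothety c x '' B1 d →
      scenery z r (cellStar c (μ, x)) ∉ N := by
  have hpush : (push (cellHomothety c x) μ).1 (B1 d) ≠ 0 := by rwa [push_apply]
  have hpull : ∀ᵐ y ∂μ.1, cellHomothety c x y ∈ cellHomothety c x '' B1 d →
      scenery (cellHomothety c x y) r (cellStar c (μ, x)) ∉ N := by
    filter_upwards [(ae_restrict_iff' measurableSet_B1).mp hN] with y hy hyB
    rw [scenery_cellStar c x y hμ hr, add_comm, ← scaleStar_scenery (Real.log_natCast_nonneg c)]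
    exact hy ((cellHomothety c x).injective.mem_set_image.mp hyB)
  rw [ae_iff, cellStar, star_apply_eq_zero_iff hpush, push_apply]
  exact hpull

namespace IsTwoSided

variable {b : ℕ} [NeZero b] {Q₀ : Measure (Radon d × E d)}
  {L : Measure (ℤ → Radon d × E d)} {ν : (ℤ → Radon d × E d) → Radon d}

lemma measurePreserving_pair_shift (h : IsTwoSided b Q₀ L ν) (k : ℤ) :
    MeasurePreserving (fun ω => (ν (shift k ω), (ω k).2)) L
      (L.map fun ω => (ν ω, (ω 0).2)) := by
  have hpair := (h.measurable_pair.measurePreserving L).comp (h.shift_preserving k)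
  simpa only [Function.comp_def, shift, zero_add] using hpair

lemma ae_scenery_notMem_of_mem_image (h : IsTwoSided b Q₀ L ν) (hb : 2 ≤ b) {N : Set (Radon d)}
    (hN : MeasurableSet N) (hnull : centering b (L.map fun ω => (ν ω, (ω 0).2)) N = 0) (m : ℕ) :
    ∀ᵐ q ∂L.prod (unifIco (Real.log b)), ∀ᵐ z ∂(ν q.1).1,
      z ∈ cellHomothety (b ^ m) (q.1 (-m)).2 '' B1 d → scenery z q.2 (ν q.1) ∉ N := by
  have := h.isProbabilityMeasure
  have hE := h.isExtendedCP
  have hscale := hE.measurePreserving_scaleStar hb (Real.log (b ^ m : ℕ))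
  have hshift : ∀ᵐ q ∂L.prod (unifIco (Real.log b)),
      ∀ᵐ y ∂(ν (shift (-m) q.1)).1.restrict (B1 d),
        scenery y q.2 (ν (shift (-m) q.1)) ∉ scaleStar (Real.log (b ^ m : ℕ)) ⁻¹' N :=
    ((h.measurePreserving_pair_shift (-m)).prod
      (MeasurePreserving.id (unifIco (Real.log b)))).quasiMeasurePreserving.ae
      ((hE.centering_apply_eq_zero_iff (hscale.measurable hN)).mp
        ((hscale.measure_preimage hN.nullMeasurableSet).trans hnull))
  filter_upwards [hshift, Measure.quasiMeasurePreserving_fst.ae h.ae_eq_cellStar,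
    Measure.quasiMeasurePreserving_fst.ae (h.ae_shift h.ae_preimage_B1_ne_zero),
    Measure.quasiMeasurePreserving_snd.ae (ae_mem_Ico_unifIco (Real.log b))] with q hq hν hcell hr
  have hcell_m := hcell (-m) m
  rw [shift, zero_add] at hcell_m
  rw [hν m]
  exact ae_scenery_cellStar_notMem (b ^ m) _ hcell_m hr.1 hq

lemma bind_diffusion_absolutelyContinuous (h : IsTwoSided b Q₀ L ν) (hb : 2 ≤ b)
    {U : Set (E d)} (hU : MeasurableSet U) :
    (centering b (L.map fun ω => (ν ω, (ω 0).2))).bind (diffusion U)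
      ≪ centering b (L.map fun ω => (ν ω, (ω 0).2)) := by
  have := h.isProbabilityMeasure
  refine Measure.AbsolutelyContinuous.mk fun N hN hnull => ?_
  have hscenery : ∀ᵐ q ∂L.prod (unifIco (Real.log b)), ∀ᵐ z ∂(ν q.1).1,
      scenery z q.2 (ν q.1) ∉ N := by
    filter_upwards [ae_all_iff.mpr (h.ae_scenery_notMem_of_mem_image hb hN hnull),
      Measure.quasiMeasurePreserving_fst.ae h.ae_concentrated] with q hq hconc
    filter_upwards [ae_all_iff.mpr hq, measure_eq_zero_iff_ae_notMem.mp hconc] with z hz hmem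
    obtain ⟨m, hm⟩ := mem_iUnion.mp (notMem_compl_iff.mp hmem)
    exact hz m hm
  have hmeas : Measurable fun p : ((Radon d × E d) × ℝ) × E d => scenery p.2 p.1.2 p.1.1.1 :=
    measurable_scenery measurable_snd measurable_fst.snd measurable_fst.fst.fst
  have hsusp : ∀ᵐ q ∂suspMeasure (Real.log b) (L.map fun ω => (ν ω, (ω 0).2)),
      ∀ᵐ z ∂q.1.1.1, scenery z q.2 q.1.1 ∉ N := by
    have hpair := (h.measurable_pair.measurePreserving L).prod
      (MeasurePreserving.id (unifIco (Real.log b)))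
    rw [suspMeasure, ← hpair.map_eq]
    exact (ae_map_iff hpair.aemeasurable
      (measurableSet_ae_section measurable_fst.fst (hmeas hN.compl))).mpr hscenery
  rw [h.isExtendedCP.bind_diffusion_centering_apply_eq_zero_iff hU hN]
  exact hsusp.mono fun q hq => hq.mono fun z hz _ => hz

end IsTwoSided

end CPCentering

theorem mainTheorem3 (d b : ℕ) [NeZero b] (hb : 2 ≤ b)
    (Q : Measure (CPCentering.Radon d × CPCentering.E d)) (hQ : CPCentering.IsCP b Q) :
    CPCentering.IsFD (CPCentering.centering b Q) ∧
    CPCentering.IsFactor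
      (CPCentering.centering b Q) CPCentering.scaleStar
      (CPCentering.suspMeasure (Real.log b) Q)
      (CPCentering.suspFlow (Real.log b) (CPCentering.magStar b)) := by
  obtain ⟨Q₀, hQ₀, L, ν, hshift, hmarginal, hmagBox, hν, htendsto, rfl⟩ := hQ
  have h : CPCentering.IsTwoSided b Q₀ L ν :=
    ⟨hQ₀, hshift, ⟨measurable_pi_apply 0, hmarginal⟩, hmagBox, hν, htendsto⟩
  have hE := h.isExtendedCP
  have hquasiPalm :
      CPCentering.QuasiPalm (CPCentering.centering b (L.map fun ω => (ν ω, (ω 0).2))) :=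
    fun _ hU _ hU0 => ⟨hE.absolutelyContinuous_bind_diffusion hU hU0,
      h.bind_diffusion_absolutelyContinuous hb hU.measurableSet⟩
  exact ⟨⟨hE.isProbabilityMeasure_centering hb, hE.ae_centering.mono fun _ => And.left,
    hE.measurePreserving_scaleStar hb, hquasiPalm⟩, hE.isFactor_centering hb⟩
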